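/- In the complex Hilbert space $L^2(\mathbf R)$ consider the operators $H_0=-\frac12\partial_x^2$ and $V=\frac12x^2$ (multiplication), each on its natural domain, $D(H_0)=\{f\in L^2: f''\in L^2\}$ ($f''$ in the sense of distributions) and $D(V)=\{f\in L^2: x^2f\in L^2\}$, and the one-dimensional harmonic oscillator $H=H_0+V=\frac12(-\partial_x^2+x^2)$ on $D(H_0)\cap D(V)$. Then $-V$, $-H_0$ and $-H$ generate strongly continuous semigroups $e^{-tV}$, $e^{-tH_0}$ and $e^{-tH}$ $(t\ge0)$ of bounded operators on $L^2(\mathbf R)$. Moreover, there exist bounded continuous functions $c,C:[0,\infty)\to\mathbf R$, independent of $n$, with $c(0)=C(0)=0$ and $c(t)>0$, $C(t)>0$ for all $t>0$, such that for all $n=1,2,\dots$ and all $t\ge0$ $$c(t)\,n^{-2}\;\le\;\Bigl\|\bigl[e^{-\frac{t}{2n}V}e^{-\frac tn H_0}e^{-\frac{t}{2n}V}\bigr]^n-e^{-tH}\Bigr\|\;\le\; C(t)\,n^{-2},$$ where $\|\cdot\|$ is the operator norm on $L^2(\mathbf R)$. -/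

import Mathlib

open MeasureTheory Filter Topology
open scoped NNReal ENNReal SchwartzMap BoundedContinuousFunction

/-! ### The exponential `exp (-tA)` of an unbounded operator -/

/-- `S` is the strongly continuous one-parameter semigroup `t ↦ exp (-tA)`: its infinitesimal
generator is exactly `-A`, domains included. -/
structure IsExpNeg {E : Type*} [NormedAddCommGroup E] [NormedSpace ℂ E]
    (A : E →ₗ.[ℂ] E) (S : ℝ≥0 → E →L[ℂ] E) : Prop where
  map_zero : S 0 = 1
  map_add : ∀ s t : ℝ≥0, S (s + t) = S s * S t
  strongly_continuous : ∀ f : E, Continuous fun t : ℝ≥0 => S t f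
  /-- `f` is in the domain of `A` with `A f = g` iff `(f - S t f) / t → g` as `t ↓ 0`. -/
  generator : ∀ f g : E, (f, g) ∈ A.graph ↔
    Tendsto (fun t : ℝ≥0 => ((t : ℝ) : ℂ)⁻¹ • (f - S t f)) (𝓝[≠] 0) (𝓝 g)

/-- A strongly continuous semigroup is determined by its generator. -/
theorem IsExpNeg.unique {E : Type*} [NormedAddCommGroup E] [NormedSpace ℂ E] [CompleteSpace E]
    {A : E →ₗ.[ℂ] E} (hA : Dense (A.domain : Set E)) {S T : ℝ≥0 → E →L[ℂ] E}
    (hS : IsExpNeg A S) (hT : IsExpNeg A T) : S = T := by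
  have inv : ∀ (f g : E), (f, g) ∈ A.graph → ∀ x, (S x f, S x g) ∈ A.graph := by
    intro f g hfg x
    rw [hS.generator] at hfg ⊢
    refine (((S x).continuous.tendsto g).comp hfg).congr fun h => ?_
    have : S h (S x f) = S x (S h f) := by
      have := congrArg (fun L : E →L[ℂ] E => L f) ((hS.map_add h x).symm.trans
        ((congrArg S (add_comm h x)).trans (hS.map_add x h)))
      simpa using this
    simp [this]
  have key : ∀ (f : E), f ∈ A.domain → ∀ t, S t f = T t f := by
    intro f hf t
    have hg : (f, A ⟨f, hf⟩) ∈ A.graph := A.mem_graph ⟨f, hf⟩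
    generalize A ⟨f, hf⟩ = g at hg
    obtain ⟨M, hM⟩ := banach_steinhaus (g := fun i : Set.Icc (0 : ℝ≥0) t => T i) fun x => by
      obtain ⟨C, hC⟩ := (isCompact_Icc (a := (0 : ℝ≥0)) (b := t)).exists_bound_of_continuousOn
        (hT.strongly_continuous x).continuousOn
      exact ⟨C, fun i => hC i i.2⟩
    have hM0 : 0 ≤ M := (norm_nonneg _).trans (hM ⟨0, by simp⟩)
    have hM' : ∀ s : ℝ, 0 ≤ s → ∀ w, ‖T (t - s).toNNReal w‖ ≤ M * ‖w‖ := fun s hs w =>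
      (T (t - s).toNNReal).le_of_opNorm_le (hM ⟨(t - s).toNNReal, by
        refine ⟨zero_le, ?_⟩
        rw [Real.toNNReal_le_iff_le_coe]; linarith⟩) w
    set ψ : ℝ → E := fun s => T (t - s).toNNReal (S s.toNNReal f) with hψ
    have hcont : ContinuousOn ψ (Set.Icc 0 t) := by
      intro x hx
      have h1 : Tendsto (fun s : ℝ => M * ‖S s.toNNReal f - S x.toNNReal f‖ +
          ‖T (t - s).toNNReal (S x.toNNReal f) - ψ x‖) (𝓝[Set.Icc 0 ↑t] x) (𝓝 0) := by
        have hc : Continuous (fun s : ℝ => M * ‖S s.toNNReal f - S x.toNNReal f‖ +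
          ‖T (t - s).toNNReal (S x.toNNReal f) - ψ x‖) := by
          have a := (hS.strongly_continuous f).comp continuous_real_toNNReal
          have b := (hT.strongly_continuous (S x.toNNReal f)).comp
            (continuous_real_toNNReal.comp (continuous_const.sub continuous_id : Continuous
              fun s : ℝ => (t : ℝ) - s))
          simp only [Function.comp_def] at a b
          exact (continuous_const.mul (a.sub continuous_const).norm).add
            (b.sub continuous_const).norm
        have := (hc.continuousWithinAt (s := Set.Icc 0 ↑t) (x := x)).tendsto
        simpa [hψ] using this
      refine tendsto_iff_norm_sub_tendsto_zero.2 (squeeze_zero' (.of_forall fun _ => norm_nonneg _)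
        ?_ h1)
      filter_upwards [self_mem_nhdsWithin] with s hs
      have : ψ s - ψ x = T (t - s).toNNReal (S s.toNNReal f - S x.toNNReal f) +
          (T (t - s).toNNReal (S x.toNNReal f) - ψ x) := by simp [hψ]
      rw [this]
      exact (norm_add_le _ _).trans (by gcongr; exact hM' s hs.1 _)
    have hder : ∀ x ∈ Set.Ico (0 : ℝ) t, HasDerivWithinAt ψ 0 (Set.Ici x) x := by
      intro x hx
      set u := S x.toNNReal f
      have hu : (u, S x.toNNReal g) ∈ A.graph := inv f g hg _
      have h1 : Tendsto (fun h : ℝ≥0 => M * ‖((h : ℝ) : ℂ)⁻¹ • (S h u - T h u)‖)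
          (𝓝[≠] 0) (𝓝 0) := by
        have := (((hT.generator _ _).1 hu).sub ((hS.generator _ _).1 hu)).norm.const_mul M
        simp only [sub_self, norm_zero, mul_zero] at this
        refine this.congr fun h => ?_
        rw [← smul_sub]; congr 3; abel
      rw [hasDerivWithinAt_iff_tendsto_slope, Set.Ici_sdiff_left]
      have h2 : Tendsto (fun y : ℝ => (y - x).toNNReal) (𝓝[>] x) (𝓝[≠] 0) := by
        refine tendsto_nhdsWithin_iff.2 ⟨?_, ?_⟩
        · have : Continuous fun y : ℝ => (y - x).toNNReal := by fun_prop
          simpa using (this.continuousWithinAt (s := Set.Ioi x) (x := x)).tendsto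
        · filter_upwards [self_mem_nhdsWithin] with y hy
          simpa using hy
      refine squeeze_zero_norm' ?_ (h1.comp h2)
      filter_upwards [Ioo_mem_nhdsGT hx.2] with y hy
      have hxy : 0 < y - x := sub_pos.2 hy.1
      have e1 : ψ y = T (t - y).toNNReal (S (y - x).toNNReal u) := by
        have : y.toNNReal = (y - x).toNNReal + x.toNNReal := by
          rw [← Real.toNNReal_add hxy.le hx.1]; simp
        simp [hψ, this, hS.map_add, u]
      have e2 : ψ x = T (t - y).toNNReal (T (y - x).toNNReal u) := by
        have : ((t : ℝ) - x).toNNReal = (t - y).toNNReal + (y - x).toNNReal := by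
          rw [← Real.toNNReal_add (sub_nonneg.2 hy.2.le) hxy.le]; simp
        simp [hψ, this, hT.map_add, u]
      rw [slope_def_module, e1, e2, ← map_sub, norm_smul, Function.comp_apply, norm_smul]
      have := hM' y (hx.1.trans hy.1.le) (S (y - x).toNNReal u - T (y - x).toNNReal u)
      rw [norm_inv, norm_inv, Complex.norm_real, Real.coe_toNNReal _ hxy.le]
      calc _ ≤ ‖y - x‖⁻¹ * (M * ‖S (y - x).toNNReal u - T (y - x).toNNReal u‖) := by gcongr
        _ = _ := by ring
    have := constant_of_has_deriv_right_zero hcont hder t ⟨t.2, le_rfl⟩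
    simpa [hψ, hS.map_zero, hT.map_zero] using this
  funext t
  refine ContinuousLinearMap.ext fun f => ?_
  exact congrFun ((S t).continuous.ext_on hA (T t).continuous fun f hf => key f hf t) f

open Classical in
/-- `exp (-tA)`, for `t ≥ 0`: the semigroup with generator `-A`
(and `0` if there is no such semigroup). -/
noncomputable def expNeg {E : Type*} [NormedAddCommGroup E] [NormedSpace ℂ E]
    (A : E →ₗ.[ℂ] E) : ℝ≥0 → E →L[ℂ] E :=
  if h : ∃ S : ℝ≥0 → E →L[ℂ] E, IsExpNeg A S then h.choose else 0

/-! ### The operators of the harmonic oscillator -/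

/-- The Hilbert space `L²(ℝ)` of complex-valued functions. -/
abbrev L2R : Type := Lp ℂ 2 (volume : Measure ℝ)

/-- The inclusion of `L²(ℝ)` into the tempered distributions. -/
noncomputable def L2R.toDistr : L2R →ₗ[ℂ] 𝓢'(ℝ, ℂ) :=
  (Lp.toTemperedDistributionCLM ℂ (volume : Measure ℝ) 2).toLinearMap

theorem L2R.toDistr_injective : Function.Injective L2R.toDistr :=
  LinearMap.ker_eq_bot.mp Lp.ker_toTemperedDistributionCLM_eq_bot

/-- `-½ ∂²` on tempered distributions. -/
noncomputable def negHalfSecondDeriv : 𝓢'(ℝ, ℂ) →ₗ[ℂ] 𝓢'(ℝ, ℂ) :=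
  (-(1 / 2 : ℂ)) • (TemperedDistribution.derivCLM ℂ ∘L
    TemperedDistribution.derivCLM ℂ).toLinearMap

/-- The free Hamiltonian `H₀ = -½ ∂²` in `L²(ℝ)`, on its natural domain, the set of all `f ∈ L²(ℝ)`
whose distributional derivative `f''` is in `L²(ℝ)`. -/
noncomputable def freeHamiltonian : L2R →ₗ.[ℂ] L2R where
  domain := (LinearMap.range L2R.toDistr).comap (negHalfSecondDeriv ∘ₗ L2R.toDistr)
  toFun := (LinearEquiv.ofInjective L2R.toDistr L2R.toDistr_injective).symm.toLinearMap ∘ₗ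
    (negHalfSecondDeriv ∘ₗ L2R.toDistr).restrict fun _ hf => hf

/-- `H₀ f = g` means `-½ f'' = g` in the sense of distributions. -/
theorem mem_graph_freeHamiltonian_iff (f g : L2R) :
    (f, g) ∈ freeHamiltonian.graph ↔
      negHalfSecondDeriv (L2R.toDistr f) = L2R.toDistr g := by
  have hE : ∀ y : LinearMap.range L2R.toDistr,
      L2R.toDistr ((LinearEquiv.ofInjective L2R.toDistr L2R.toDistr_injective).symm y) = y :=
    fun y => congrArg Subtype.val
      ((LinearEquiv.ofInjective L2R.toDistr L2R.toDistr_injective).apply_symm_apply y)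
  rw [LinearPMap.mem_graph_iff]
  constructor
  · rintro ⟨y, rfl, rfl⟩
    exact (hE ⟨_, y.2⟩).symm
  · intro h
    refine ⟨⟨f, ⟨g, h.symm⟩⟩, rfl, L2R.toDistr_injective ?_⟩
    exact (hE _).trans h

/-- The potential `V(x) = ½ x²`. -/
noncomputable def potentialFun (x : ℝ) : ℂ := ((x ^ 2 / 2 : ℝ) : ℂ)

/-- The operator of multiplication by `V(x) = ½ x²` in `L²(ℝ)`, on its natural domain, the set of
all `f ∈ L²(ℝ)` with `V f ∈ L²(ℝ)`. -/
noncomputable def potential : L2R →ₗ.[ℂ] L2R where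
  domain :=
    { carrier := {f | MemLp (fun x => potentialFun x * f x) 2 volume}
      zero_mem' := by
        refine (MemLp.zero (p := 2)).ae_eq ?_
        filter_upwards [Lp.coeFn_zero ℂ 2 (volume : Measure ℝ)] with x _
        simp
      add_mem' := by
        intro f g hf hg
        refine (MemLp.add hf hg).ae_eq ?_
        filter_upwards [Lp.coeFn_add f g] with x hx
        rw [hx]
        exact (mul_add _ _ _).symm
      smul_mem' := by
        intro a f hf
        refine (MemLp.const_smul hf a).ae_eq ?_
        filter_upwards [Lp.coeFn_smul a f] with x hx
        simp [hx, mul_left_comm] }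
  toFun :=
    { toFun := fun f => MemLp.toLp (fun x => potentialFun x * f.1 x) f.2
      map_add' := by
        intro f g
        rw [← MemLp.toLp_add, MemLp.toLp_eq_toLp_iff]
        filter_upwards [Lp.coeFn_add f.1 g.1] with x hx
        exact (congrArg (potentialFun x * ·) hx).trans (mul_add _ _ _)
      map_smul' := by
        intro a f
        rw [RingHom.id_apply, ← MemLp.toLp_const_smul, MemLp.toLp_eq_toLp_iff]
        filter_upwards [Lp.coeFn_smul a f.1] with x hx
        simp [hx, mul_left_comm] }

/-- The harmonic oscillator `H = H₀ + V = ½ (-∂² + x²)`, with domain `D(H₀) ∩ D(V)`. -/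
noncomputable def harmonicOscillator : L2R →ₗ.[ℂ] L2R := freeHamiltonian + potential

/-! ### Multiplication operators on `L²(ℝ)` -/

/-! The product formula for the oscillator is exactly solvable. Put H_ω = ω⁻¹ H₀ + ω V. Then exp(-s
H_ω) is the symmetric product of exp(-ω tanh(s/2) V), exp(-ω⁻¹ sinh s H₀) and exp(-ω tanh(s/2) V).
Conversely, for u = t/(2n), the single step exp(-uV) exp(-2uH₀) exp(-uV) is exp(-2 arsinh(u) H_ω)
with ω = √(1+u²). Its n-th power is therefore exp(-s H_ω) with s = 2n arsinh u ≤ t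
(`product_pow_eq_oscSemigroup`), and the error comes only from a frequency shift ω - 1 ≤ u²/2 and a
relative time shift (t-s)/s ≤ u²/2.

Lower bound: exp(-s H_ω) has norm e^(-s/2) for every ω > 0, so the error is at least e^(-s/2) -
e^(-t/2) ≥ e^(-t/2) (t-s)/2, and t - s = 2n(u - arsinh u) is cubic in u.

Upper bound: changing the frequency costs at most 3(ω-1) (`norm_oscSemigroup_sub_le_freq`) and
changing the time at most (t-s)/s (`norm_oscSemigroup_sub_le_time`). Halving the times gains a
factor e^(-s/4) (`norm_oscSemigroup_sub_le`), which keeps the constant bounded as t grows.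

The product forms, and with them the semigroup law, are verified on the Gaussians exp(-βx²/2 + zx):
multiplication by exp(-aV) and the heat flow act on them explicitly, and those with z purely
imaginary are total in L². No Hermite basis is needed: the norm follows from the growth of powers of
a symmetric operator on the span of these Gaussians.

It remains to see that the case ω = 1 is the semigroup with generator -H, on the domain D(H₀) ∩ D(V)
exactly. Differentiating the product shows that its generator extends -H. Conversely, the semigroup
maps L² into D(H₀) ∩ D(V), and the estimate ‖Vh‖² ≤ ‖Hh‖² + ½‖h‖² lets one pass to the limit along
exp(-εH) f (`mem_graph_of_tendsto_oscSemigroup`). -/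

theorem memLp_mul_of_bounded (m : ℝ →ᵇ ℂ) (f : L2R) :
    MemLp (fun x => m x * f x) 2 volume := by
  refine (Lp.memLp f).of_le_mul (c := ‖m‖)
    (m.continuous.aestronglyMeasurable.mul (Lp.aestronglyMeasurable f)) (.of_forall fun x => ?_)
  rw [norm_mul]
  gcongr
  exact m.norm_coe_le_norm x

/-- The operator of multiplication by a bounded continuous function. -/
noncomputable def mulOp (m : ℝ →ᵇ ℂ) : L2R →L[ℂ] L2R :=
  LinearMap.mkContinuous
    { toFun := fun f => (memLp_mul_of_bounded m f).toLp _
      map_add' := by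
        intro f g
        rw [← MemLp.toLp_add, MemLp.toLp_eq_toLp_iff]
        filter_upwards [Lp.coeFn_add f g] with x hx
        rw [hx, Pi.add_apply, Pi.add_apply, mul_add]
      map_smul' := by
        intro a f
        rw [RingHom.id_apply, ← MemLp.toLp_const_smul, MemLp.toLp_eq_toLp_iff]
        filter_upwards [Lp.coeFn_smul a f] with x hx
        simp [hx, mul_left_comm] } ‖m‖ <| by
    intro f
    refine Lp.norm_le_mul_norm_of_ae_le_mul ?_
    filter_upwards [(memLp_mul_of_bounded m f).coeFn_toLp] with x hx
    simp only [LinearMap.coe_mk, AddHom.coe_mk, hx, norm_mul]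
    gcongr
    exact m.norm_coe_le_norm x

theorem coeFn_mulOp (m : ℝ →ᵇ ℂ) (f : L2R) : mulOp m f =ᵐ[volume] fun x => m x * f x :=
  (memLp_mul_of_bounded m f).coeFn_toLp

theorem norm_mulOp_le {m : ℝ →ᵇ ℂ} {C : ℝ} (hC : 0 ≤ C) (h : ∀ x, ‖m x‖ ≤ C) : ‖mulOp m‖ ≤ C :=
  (LinearMap.mkContinuous_norm_le _ (norm_nonneg m) _).trans
    ((BoundedContinuousFunction.norm_le hC).2 h)

theorem mulOp_mul (m k : ℝ →ᵇ ℂ) : mulOp (m * k) = mulOp m * mulOp k := by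
  ext1 f
  refine Lp.ext ?_
  filter_upwards [coeFn_mulOp (m * k) f, coeFn_mulOp m (mulOp k f), coeFn_mulOp k f]
    with x h1 h2 h3
  simp [h1, h2, h3, mul_assoc]

theorem mulOp_sub (m k : ℝ →ᵇ ℂ) : mulOp (m - k) = mulOp m - mulOp k := by
  ext1 f
  refine Lp.ext ?_
  filter_upwards [coeFn_mulOp (m - k) f, coeFn_mulOp m f, coeFn_mulOp k f,
    Lp.coeFn_sub (mulOp m f) (mulOp k f)] with x h1 h2 h3 h4
  rw [sub_apply, h4, Pi.sub_apply, h1, h2, h3, BoundedContinuousFunction.coe_sub,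
    Pi.sub_apply, sub_mul]

theorem mulOp_smul (a : ℂ) (m : ℝ →ᵇ ℂ) : mulOp (a • m) = a • mulOp m := by
  ext1 f
  refine Lp.ext ?_
  filter_upwards [coeFn_mulOp (a • m) f, coeFn_mulOp m f, Lp.coeFn_smul a (mulOp m f)]
    with x h1 h2 h3
  simp [h1, h2, h3, mul_assoc]

theorem mulOp_one : mulOp 1 = 1 := by
  ext1 f
  refine Lp.ext ?_
  filter_upwards [coeFn_mulOp 1 f] with x h1
  simp [h1]

theorem inner_mulOp_left {m : ℝ →ᵇ ℂ} (hm : ∀ x, starRingEnd ℂ (m x) = m x) (f g : L2R) :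
    inner ℂ (mulOp m f) g = inner ℂ f (mulOp m g) := by
  rw [L2.inner_def, L2.inner_def]
  refine integral_congr_ae ?_
  filter_upwards [coeFn_mulOp m f, coeFn_mulOp m g] with x h1 h2
  simp only [h1, h2, RCLike.inner_apply, map_mul, hm]
  ring

theorem norm_sq_eq_integral (f : L2R) : ‖f‖ ^ 2 = ∫ x, ‖f x‖ ^ 2 := by
  have h : (inner ℂ f f : ℂ) = ((∫ x, ‖f x‖ ^ 2 : ℝ) : ℂ) := by
    rw [L2.inner_def, ← integral_complex_ofReal]
    refine integral_congr_ae (.of_forall fun x => ?_)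
    simp [inner_self_eq_norm_sq_to_K]
  rw [inner_self_eq_norm_sq_to_K] at h
  exact Complex.ofReal_injective (by simpa using h)

/-- Dominated convergence in `L²`, for multiplication operators. -/
theorem tendsto_mulOp_of_dominated {ι : Type*} {l : Filter ι} [l.IsCountablyGenerated]
    {m : ι → ℝ →ᵇ ℂ} {f g : L2R} {C : ℝ}
    (hb : ∀ᶠ i in l, ∀ᵐ x, ‖m i x * f x‖ ≤ C * ‖g x‖ + C * ‖f x‖)
    (hlim : ∀ᵐ x, Tendsto (fun i => m i x * f x) l (𝓝 (g x))) :
    Tendsto (fun i => mulOp (m i) f) l (𝓝 g) := by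
  rw [tendsto_iff_norm_sub_tendsto_zero]
  have key : Tendsto (fun i => ∫ x, ‖m i x * f x - g x‖ ^ 2) l (𝓝 (∫ x : ℝ, (0 : ℝ))) := by
    refine tendsto_integral_filter_of_dominated_convergence
      (fun x => ((C + 1) * ‖g x‖ + C * ‖f x‖) ^ 2) ?_ ?_ ?_ ?_
    · refine .of_forall fun i => ?_
      have := (((m i).continuous.aestronglyMeasurable.mul
        (Lp.aestronglyMeasurable f)).sub (Lp.aestronglyMeasurable g)).norm.pow 2
      exact this
    · filter_upwards [hb] with i hi
      filter_upwards [hi] with x hx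
      rw [Real.norm_of_nonneg (by positivity)]
      gcongr
      calc _ ≤ ‖m i x * f x‖ + ‖g x‖ := norm_sub_le _ _
        _ ≤ _ := by linarith
    · exact MemLp.integrable_sq
        (((Lp.memLp g).norm.const_mul (C + 1)).add ((Lp.memLp f).norm.const_mul C))
    · filter_upwards [hlim] with x hx
      have := ((hx.sub_const (g x)).norm.pow 2)
      simpa using this
  rw [integral_zero] at key
  have key2 := (Real.continuous_sqrt.tendsto 0).comp key
  rw [Real.sqrt_zero] at key2
  refine key2.congr fun i => ?_
  have : ‖mulOp (m i) f - g‖ ^ 2 = ∫ x, ‖m i x * f x - g x‖ ^ 2 := by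
    rw [norm_sq_eq_integral]
    refine integral_congr_ae ?_
    filter_upwards [Lp.coeFn_sub (mulOp (m i) f) g, coeFn_mulOp (m i) f] with x h1 h2
    rw [h1, Pi.sub_apply, h2]
  rw [Function.comp_apply, ← this, Real.sqrt_sq (norm_nonneg _)]

/-- An L² limit is an almost everywhere limit along a subsequence, hence agrees with any pointwise
limit. This gives the generator's action without assuming a priori that F is square integrable. -/
theorem eq_of_tendsto_mulOp {m : ℕ → ℝ →ᵇ ℂ} {f g : L2R} {F : ℝ → ℂ}
    (h : Tendsto (fun i => mulOp (m i) f) atTop (𝓝 g))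
    (hlim : ∀ x, Tendsto (fun i => m i x * f x) atTop (𝓝 (F x))) : g =ᵐ[volume] F := by
  obtain ⟨ns, hns, hae⟩ := (tendstoInMeasure_of_tendsto_Lp h).exists_seq_tendsto_ae
  filter_upwards [hae, ae_all_iff.2 fun i => coeFn_mulOp (m i) f] with x h1 h2
  refine tendsto_nhds_unique h1 ?_
  simp only [h2]
  exact (hlim x).comp hns.tendsto_atTop

/-! ### Multiplication semigroups -/

/-- The bounded function `exp (-|t| W)`. -/
noncomputable def expSymbol (W : C(ℝ, ℝ≥0)) (t : ℝ) : ℝ →ᵇ ℂ :=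
  BoundedContinuousFunction.ofNormedAddCommGroup
    (fun x => ((Real.exp (-(|t| * W x)) : ℝ) : ℂ)) (by fun_prop) 1 fun x => by
      rw [Complex.norm_real, Real.norm_of_nonneg (Real.exp_pos _).le, Real.exp_le_one_iff,
        neg_nonpos]
      positivity

theorem expSymbol_apply (W : C(ℝ, ℝ≥0)) (t x : ℝ) :
    expSymbol W t x = ((Real.exp (-(|t| * W x)) : ℝ) : ℂ) := rfl

/-- The operator of multiplication by `exp (-|t| W)`. -/
noncomputable def expMul (W : C(ℝ, ℝ≥0)) (t : ℝ) : L2R →L[ℂ] L2R := mulOp (expSymbol W t)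

theorem expMul_zero (W : C(ℝ, ℝ≥0)) : expMul W 0 = 1 := by
  rw [expMul, ← mulOp_one]
  congr 1
  ext x
  simp [expSymbol_apply]

theorem expMul_add (W : C(ℝ, ℝ≥0)) {s t : ℝ} (hs : 0 ≤ s) (ht : 0 ≤ t) :
    expMul W (s + t) = expMul W s * expMul W t := by
  rw [expMul, expMul, expMul, ← mulOp_mul]
  congr 1
  ext x
  simp only [expSymbol_apply, BoundedContinuousFunction.coe_mul, Pi.mul_apply,
    abs_of_nonneg hs, abs_of_nonneg ht, abs_of_nonneg (add_nonneg hs ht)]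
  rw [← Complex.ofReal_mul, ← Real.exp_add]
  congr 2
  ring

theorem norm_expSymbol_apply_le (W : C(ℝ, ℝ≥0)) (t x : ℝ) : ‖expSymbol W t x‖ ≤ 1 := by
  rw [expSymbol_apply, Complex.norm_real, Real.norm_of_nonneg (Real.exp_pos _).le,
    Real.exp_le_one_iff, neg_nonpos]
  positivity

theorem norm_expMul_le (W : C(ℝ, ℝ≥0)) (t : ℝ) : ‖expMul W t‖ ≤ 1 :=
  norm_mulOp_le zero_le_one (norm_expSymbol_apply_le W t)

theorem inner_expMul_left (W : C(ℝ, ℝ≥0)) (t : ℝ) (f g : L2R) :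
    inner ℂ (expMul W t f) g = inner ℂ f (expMul W t g) :=
  inner_mulOp_left (fun _ => Complex.conj_ofReal _) f g

theorem continuous_expMul (W : C(ℝ, ℝ≥0)) (f : L2R) : Continuous fun t : ℝ => expMul W t f := by
  refine continuous_iff_continuousAt.2 fun t => ?_
  refine tendsto_mulOp_of_dominated (C := 1) ?_ ?_
  · refine .of_forall fun s => .of_forall fun x => ?_
    rw [norm_mul]
    nlinarith [norm_expSymbol_apply_le W s x, norm_nonneg (f x), norm_nonneg (expMul W t f x)]
  · filter_upwards [coeFn_mulOp (expSymbol W t) f] with x hx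
    rw [expMul, hx]
    have : Continuous fun s => expSymbol W s x * f x := by
      simp only [expSymbol_apply]
      fun_prop
    exact this.tendsto t

/-- Pointwise, e^(-sw) (1 - e^(-(t-s)w)) ≤ (t-s) w e^(-sw), and s w e^(-sw) ≤ 1. The bound depends
only on the ratio t/s. -/
theorem norm_expMul_sub_le (W : C(ℝ, ℝ≥0)) {s t : ℝ} (hs : 0 < s) (hst : s ≤ t) :
    ‖expMul W s - expMul W t‖ ≤ (t - s) / s := by
  rw [expMul, expMul, ← mulOp_sub]
  refine norm_mulOp_le (div_nonneg (sub_nonneg.2 hst) hs.le) fun x => ?_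
  simp only [BoundedContinuousFunction.coe_sub, Pi.sub_apply, expSymbol_apply]
  rw [← Complex.ofReal_sub, Complex.norm_real, abs_of_pos hs, abs_of_pos (hs.trans_le hst)]
  set w : ℝ := (W x : ℝ)
  have hw : 0 ≤ w := (W x).coe_nonneg
  have h1 : Real.exp (-(t * w)) = Real.exp (-(s * w)) * Real.exp (-((t - s) * w)) := by
    rw [← Real.exp_add]; ring_nf
  have h2 := Real.add_one_le_exp (-((t - s) * w))
  have h3 : Real.exp (-((t - s) * w)) ≤ 1 := by
    rw [Real.exp_le_one_iff, neg_nonpos]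
    exact mul_nonneg (sub_nonneg.2 hst) hw
  have h4 := Real.add_one_le_exp (s * w)
  have h5 : s * w * Real.exp (-(s * w)) ≤ 1 := by
    rw [Real.exp_neg, ← div_eq_mul_inv, div_le_one (Real.exp_pos _)]
    linarith
  rw [h1, Real.norm_of_nonneg (by nlinarith [Real.exp_pos (-(s * w))]), le_div_iff₀ hs]
  calc (Real.exp (-(s * w)) - Real.exp (-(s * w)) * Real.exp (-((t - s) * w))) * s
      = Real.exp (-(s * w)) * (1 - Real.exp (-((t - s) * w))) * s := by ring
    _ ≤ Real.exp (-(s * w)) * ((t - s) * w) * s := by gcongr; linarith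
    _ = (t - s) * (s * w * Real.exp (-(s * w))) := by ring
    _ ≤ (t - s) * 1 := by gcongr
    _ = t - s := mul_one _

/-- The difference quotients of the multiplication semigroup `exp (-t W)` at `0`. -/
theorem tendsto_expMul_iff (W : C(ℝ, ℝ≥0)) (f g : L2R) :
    Tendsto (fun t : ℝ≥0 => ((t : ℝ) : ℂ)⁻¹ • (f - expMul W t f)) (𝓝[≠] 0) (𝓝 g) ↔
      g =ᵐ[volume] fun x => ((W x : ℝ) : ℂ) * f x := by
  set m : ℝ≥0 → ℝ →ᵇ ℂ := fun t => ((t : ℝ) : ℂ)⁻¹ • (1 - expSymbol W t) with hm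
  have hop : (fun t : ℝ≥0 => ((t : ℝ) : ℂ)⁻¹ • (f - expMul W t f)) = fun t => mulOp (m t) f := by
    funext t
    simp [hm, mulOp_smul, mulOp_sub, mulOp_one, expMul]
  have hmx : ∀ t x, m t x = (((t : ℝ)⁻¹ * (1 - Real.exp (-(t * W x))) : ℝ) : ℂ) := by
    intro t x
    simp [hm, expSymbol_apply]
  have hlim : ∀ x, Tendsto (fun t => m t x) (𝓝[≠] 0) (𝓝 ((W x : ℝ) : ℂ)) := by
    intro x
    simp only [hmx]
    refine (Complex.continuous_ofReal.tendsto _).comp ?_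
    have hd : HasDerivAt (fun t : ℝ => - Real.exp (-(t * W x))) (W x) 0 := by
      have := (((hasDerivAt_id (0 : ℝ)).mul_const ((W x : ℝ))).neg.exp).neg
      refine this.congr_deriv ?_
      simp
    rw [hasDerivAt_iff_tendsto_slope] at hd
    have hc : Tendsto (fun t : ℝ≥0 => (t : ℝ)) (𝓝[≠] 0) (𝓝[≠] 0) := by
      refine tendsto_nhdsWithin_iff.2 ⟨?_, ?_⟩
      · exact (NNReal.continuous_coe.tendsto' 0 0 rfl).mono_left nhdsWithin_le_nhds
      · filter_upwards [self_mem_nhdsWithin] with t ht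
        simpa using ht
    refine (hd.comp hc).congr fun t => ?_
    simp only [Function.comp_apply, slope_def_module, sub_zero, smul_eq_mul, zero_mul, neg_zero,
      Real.exp_zero]
    ring
  rw [hop]
  constructor
  · intro h
    have hs : Tendsto (fun n : ℕ => (1 / ((n : ℝ≥0) + 1))) atTop (𝓝[≠] 0) := by
      refine tendsto_nhdsWithin_iff.2 ⟨tendsto_one_div_add_atTop_nhds_zero_nat, ?_⟩
      exact .of_forall fun n => by simp
    exact eq_of_tendsto_mulOp (h.comp hs) fun x => ((hlim x).comp hs).mul_const _
  · intro h
    refine tendsto_mulOp_of_dominated (C := 1) ?_ ?_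
    · filter_upwards [self_mem_nhdsWithin] with t ht
      have ht' : (0 : ℝ) < t := by
        have : (0 : ℝ≥0) < t := pos_iff_ne_zero.2 ht
        exact_mod_cast this
      filter_upwards [h] with x hx
      have hw : (0 : ℝ) ≤ W x := (W x).coe_nonneg
      have h2 := Real.add_one_le_exp (-(t * W x : ℝ))
      have h3 : Real.exp (-(t * W x : ℝ)) ≤ 1 := by
        rw [Real.exp_le_one_iff, neg_nonpos]
        positivity
      -- The difference quotients (1 - e^(-tw))/t are bounded by w, so g itself dominates.
      have h4 : ‖m t x‖ ≤ W x := by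
        rw [hmx, Complex.norm_real, Real.norm_of_nonneg
          (mul_nonneg (inv_nonneg.2 ht'.le) (by linarith)), inv_mul_le_iff₀ ht']
        linarith
      rw [hx, norm_mul, norm_mul, Complex.norm_real, Real.norm_of_nonneg hw]
      nlinarith [norm_nonneg (f x)]
    · filter_upwards [h] with x hx
      rw [hx]
      exact (hlim x).mul_const _

/-- `exp (-t W)` maps into the domain of multiplication by `W`. -/
theorem exists_coeFn_eq_mul_expMul (W : C(ℝ, ℝ≥0)) {t : ℝ} (ht : 0 < t) (f : L2R) :
    ∃ g : L2R, g =ᵐ[volume] fun x => ((W x : ℝ) : ℂ) * expMul W t f x := by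
  let m : ℝ →ᵇ ℂ := BoundedContinuousFunction.ofNormedAddCommGroup
    (fun x => ((W x : ℝ) : ℂ) * expSymbol W t x) (by fun_prop) t⁻¹ fun x => by
      have h4 := Real.add_one_le_exp (t * W x)
      rw [expSymbol_apply, norm_mul, Complex.norm_real, Complex.norm_real,
        Real.norm_of_nonneg (W x).coe_nonneg, Real.norm_of_nonneg (Real.exp_pos _).le, abs_of_pos ht,
        Real.exp_neg, ← div_eq_mul_inv, div_le_iff₀ (Real.exp_pos _), inv_mul_eq_div,
        le_div_iff₀ ht]
      linarith
  refine ⟨mulOp m f, ?_⟩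
  filter_upwards [coeFn_mulOp m f, coeFn_mulOp (expSymbol W t) f] with x h1 h2
  rw [h1, expMul, h2, ← mul_assoc]
  rfl

/-- The relation g = W f is equivalent to (1+W)⁻¹(f+g) = f, which involves only a bounded operator.
-/
theorem isClosed_setOf_coeFn_eq_mul (W : C(ℝ, ℝ≥0)) :
    IsClosed {p : L2R × L2R | p.2 =ᵐ[volume] fun x => ((W x : ℝ) : ℂ) * p.1 x} := by
  let m : ℝ →ᵇ ℂ := BoundedContinuousFunction.ofNormedAddCommGroup
    (fun x => (((1 + (W x : ℝ))⁻¹ : ℝ) : ℂ)) (by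
      refine Complex.continuous_ofReal.comp (Continuous.inv₀ (by fun_prop) fun x => ?_)
      have : (0 : ℝ) ≤ W x := (W x).coe_nonneg
      positivity) 1 fun x => by
      have : (0 : ℝ) ≤ W x := (W x).coe_nonneg
      rw [Complex.norm_real, Real.norm_of_nonneg (by positivity)]
      exact inv_le_one_of_one_le₀ (by linarith)
  have : {p : L2R × L2R | p.2 =ᵐ[volume] fun x => ((W x : ℝ) : ℂ) * p.1 x} =
      {p | mulOp m (p.1 + p.2) = p.1} := by
    ext ⟨f, g⟩
    have hm : ∀ x, (1 + ((W x : ℝ) : ℂ)) * m x = 1 := fun x => by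
      have h0 : (0 : ℝ) ≤ W x := (W x).coe_nonneg
      have h1 : (1 + (W x : ℝ)) * (1 + (W x : ℝ))⁻¹ = 1 := mul_inv_cancel₀ (by positivity)
      change (1 + ((W x : ℝ) : ℂ)) * (((1 + (W x : ℝ))⁻¹ : ℝ) : ℂ) = 1
      exact_mod_cast h1
    constructor
    · intro h
      refine Lp.ext ?_
      filter_upwards [coeFn_mulOp m (f + g), Lp.coeFn_add f g, h] with x h1 h2 h3
      rw [h1, h2, Pi.add_apply, h3]
      linear_combination (f x) * hm x
    · intro h
      change mulOp m (f + g) = f at h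
      change g =ᵐ[volume] _
      have h' := coeFn_mulOp m (f + g)
      rw [h] at h'
      filter_upwards [h', Lp.coeFn_add f g] with x h1 h2
      rw [h2, Pi.add_apply] at h1
      linear_combination (-(1 + ((W x : ℝ) : ℂ))) * h1 + (-(f x + g x)) * hm x
  rw [this]
  exact isClosed_eq ((mulOp m).continuous.comp (continuous_fst.add continuous_snd)) continuous_fst

/-! ### The Fourier transform on `L²(ℝ)` and the heat semigroup -/

open FourierTransform in
-- The L² transform agrees with the distributional one, and for integrable f the transform moves
-- onto the test function by Fubini.
theorem coeFn_fourier_toLp {f : ℝ → ℂ} (hf : Integrable f) (hf2 : MemLp f 2 volume)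
    {g : L2R} (hg : g =ᵐ[volume] 𝓕 f) :
    Lp.fourierTransformₗᵢ ℝ ℂ (hf2.toLp f) = g := by
  refine L2R.toDistr_injective ?_
  have h1 : L2R.toDistr (Lp.fourierTransformₗᵢ ℝ ℂ (hf2.toLp f)) =
      𝓕 (L2R.toDistr (hf2.toLp f)) :=
    (Lp.fourier_toTemperedDistribution_eq (hf2.toLp f)).symm
  rw [h1]
  ext φ
  have h2 : ∀ (u : L2R) (ψ : 𝓢(ℝ, ℂ)), L2R.toDistr u ψ = ∫ x, ψ x • u x := fun u ψ =>
    Lp.toTemperedDistribution_apply u ψ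
  rw [TemperedDistribution.fourier_apply, h2, h2]
  have h3 : ∫ x, (𝓕 φ) x • (hf2.toLp f) x = ∫ x, (𝓕 φ) x • f x := by
    refine integral_congr_ae ?_
    filter_upwards [hf2.coeFn_toLp] with x hx
    rw [hx]
  have h4 : ∫ x, φ x • g x = ∫ x, φ x • (𝓕 f) x := by
    refine integral_congr_ae ?_
    filter_upwards [hg] with x hx
    rw [hx]
  rw [h3, h4]
  have := VectorFourier.integral_fourierIntegral_smul_eq_flip (L := innerₗ ℝ)
      Real.continuous_fourierChar continuous_inner φ.integrable hf (μ := volume) (ν := volume)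
  simpa using! this

/-- The symbol `2 π² ξ²` of `-½ ∂²`. -/
noncomputable def kineticSymbol : C(ℝ, ℝ≥0) :=
  ⟨fun ξ => Real.toNNReal (2 * Real.pi ^ 2 * ξ ^ 2), by fun_prop⟩

theorem kineticSymbol_apply (ξ : ℝ) : (kineticSymbol ξ : ℝ) = 2 * Real.pi ^ 2 * ξ ^ 2 :=
  Real.coe_toNNReal _ (by positivity)

open FourierTransform in
-- Each derivative contributes a factor 2πiξ, and -½(2πiξ)² = 2π²ξ². The right side is an integral
-- against a test function because the product need not lie in L².
theorem fourier_negHalfSecondDeriv_apply (f : L2R) (φ : 𝓢(ℝ, ℂ)) :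
    𝓕 (negHalfSecondDeriv (L2R.toDistr f)) φ =
      ∫ x, φ x • (((kineticSymbol x : ℝ) : ℂ) * Lp.fourierTransformₗᵢ ℝ ℂ f x) := by
  have hd : ∀ u : 𝓢'(ℝ, ℂ), TemperedDistribution.derivCLM ℂ u =
      LineDeriv.lineDerivOp (1 : ℝ) u := by
    intro u
    ext ψ
    rw [TemperedDistribution.derivCLM_apply_apply, TemperedDistribution.lineDerivOp_apply_apply]
    congr 1
  have ht : (fun x : ℝ => inner ℝ x (1 : ℝ)).HasTemperateGrowth := by fun_prop
  have h1 : 𝓕 (negHalfSecondDeriv (L2R.toDistr f)) = (-(1 / 2 : ℂ)) •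
      𝓕 (LineDeriv.lineDerivOp (1 : ℝ) (LineDeriv.lineDerivOp (1 : ℝ) (L2R.toDistr f))) := by
    rw [← hd, ← hd, ← fourier_smul]
    rfl
  rw [h1, TemperedDistribution.fourier_lineDerivOp_eq, TemperedDistribution.fourier_lineDerivOp_eq]
  have h2 : 𝓕 (L2R.toDistr f) = L2R.toDistr (Lp.fourierTransformₗᵢ ℝ ℂ f) :=
    Lp.fourier_toTemperedDistribution_eq f
  rw [h2]
  have h3 : ∀ (u : L2R) (ψ : 𝓢(ℝ, ℂ)), L2R.toDistr u ψ = ∫ x, ψ x • u x := fun u ψ =>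
    Lp.toTemperedDistribution_apply u ψ
  simp only [map_smul]
  simp only [smul_apply, TemperedDistribution.smulLeftCLM_apply_apply, h3]
  have ht' : (fun x : ℝ => ((inner ℝ x (1 : ℝ) : ℝ) : ℂ)).HasTemperateGrowth := by fun_prop
  simp only [SchwartzMap.smulLeftCLM_apply_apply ht', smul_eq_mul, kineticSymbol_apply]
  rw [← integral_const_mul, ← integral_const_mul, ← integral_const_mul]
  refine integral_congr_ae (.of_forall fun x => ?_)
  have hI := Complex.I_sq
  simp only [RCLike.inner_apply, conj_trivial, one_mul]
  push_cast
  linear_combination (-2 * (Real.pi : ℂ) ^ 2 * x ^ 2 * φ x *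
    Lp.fourierTransformₗᵢ ℝ ℂ f x) * hI

theorem locallyIntegrable_mul_coeFn (W : C(ℝ, ℝ≥0)) (f : L2R) :
    LocallyIntegrable (fun x => ((W x : ℝ) : ℂ) * f x) :=
  ((Lp.memLp f).locallyIntegrable one_le_two).continuous_mul (by fun_prop)

open FourierTransform in
/-- In Fourier space, `H₀` is the operator of multiplication by `2 π² ξ²`. -/
theorem mem_graph_freeHamiltonian_iff_fourier (f g : L2R) :
    (f, g) ∈ freeHamiltonian.graph ↔ Lp.fourierTransformₗᵢ ℝ ℂ g =ᵐ[volume]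
      fun x => ((kineticSymbol x : ℝ) : ℂ) * Lp.fourierTransformₗᵢ ℝ ℂ f x := by
  have hg : ∀ φ : 𝓢(ℝ, ℂ), 𝓕 (L2R.toDistr g) φ =
      ∫ x, φ x • Lp.fourierTransformₗᵢ ℝ ℂ g x := fun φ => by
    have : 𝓕 (L2R.toDistr g) = L2R.toDistr (Lp.fourierTransformₗᵢ ℝ ℂ g) :=
      Lp.fourier_toTemperedDistribution_eq g
    rw [this]
    exact Lp.toTemperedDistribution_apply _ φ
  rw [mem_graph_freeHamiltonian_iff]
  constructor
  · intro h
    -- Two locally integrable functions with the same integrals against compactly supported smooth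
    -- functions agree almost everywhere.
    refine ae_eq_of_integral_contDiff_smul_eq ((Lp.memLp _).locallyIntegrable one_le_two)
      (locallyIntegrable_mul_coeFn _ _) fun φ hφ hφc => ?_
    have h1 : HasCompactSupport (Complex.ofRealCLM ∘ φ) := hφc.comp_left rfl
    have h2 : ContDiff ℝ (⊤ : ℕ∞) (Complex.ofRealCLM ∘ φ) := by fun_prop
    have h3 := fourier_negHalfSecondDeriv_apply f (h1.toSchwartzMap h2)
    rw [h, hg] at h3
    simpa using h3
  · intro h
    have : 𝓕 (negHalfSecondDeriv (L2R.toDistr f)) = 𝓕 (L2R.toDistr g) := by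
      ext φ
      rw [fourier_negHalfSecondDeriv_apply, hg]
      refine integral_congr_ae ?_
      filter_upwards [h] with x hx
      rw [hx]
    have h2 := congrArg (fun u : 𝓢'(ℝ, ℂ) => (𝓕⁻ u : 𝓢'(ℝ, ℂ))) this
    simpa using h2

/-- The heat semigroup `exp (-|t| H₀)`. -/
noncomputable def heat (t : ℝ) : L2R →L[ℂ] L2R :=
  ((Lp.fourierTransformₗᵢ ℝ ℂ).symm : L2R →L[ℂ] L2R) ∘L expMul kineticSymbol t ∘L
    ((Lp.fourierTransformₗᵢ ℝ ℂ : L2R ≃ₗᵢ[ℂ] L2R) : L2R →L[ℂ] L2R)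

theorem heat_apply (t : ℝ) (f : L2R) : heat t f = (Lp.fourierTransformₗᵢ ℝ ℂ).symm
    (expMul kineticSymbol t (Lp.fourierTransformₗᵢ ℝ ℂ f)) := rfl

theorem fourier_heat (t : ℝ) (f : L2R) : Lp.fourierTransformₗᵢ ℝ ℂ (heat t f) =
    expMul kineticSymbol t (Lp.fourierTransformₗᵢ ℝ ℂ f) := by
  rw [heat_apply, LinearIsometryEquiv.apply_symm_apply]

theorem heat_zero : heat 0 = 1 := by
  ext1 f
  simp [heat_apply, expMul_zero]

theorem heat_add {s t : ℝ} (hs : 0 ≤ s) (ht : 0 ≤ t) : heat (s + t) = heat s * heat t := by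
  ext1 f
  simp [heat_apply, expMul_add _ hs ht]

theorem norm_heat_le (t : ℝ) : ‖heat t‖ ≤ 1 := by
  refine ContinuousLinearMap.opNorm_le_bound _ zero_le_one fun f => ?_
  rw [heat_apply, LinearIsometryEquiv.norm_map]
  simpa using (expMul kineticSymbol t).le_of_opNorm_le (norm_expMul_le _ t)
    (Lp.fourierTransformₗᵢ ℝ ℂ f)

theorem norm_heat_sub_le {s t : ℝ} (hs : 0 < s) (hst : s ≤ t) :
    ‖heat s - heat t‖ ≤ (t - s) / s := by
  refine ContinuousLinearMap.opNorm_le_bound _ (div_nonneg (sub_nonneg.2 hst) hs.le) fun f => ?_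
  rw [sub_apply, heat_apply, heat_apply, ← map_sub, LinearIsometryEquiv.norm_map]
  simpa using (expMul kineticSymbol s - expMul kineticSymbol t).le_of_opNorm_le
    (norm_expMul_sub_le _ hs hst) (Lp.fourierTransformₗᵢ ℝ ℂ f)

theorem inner_heat_left (t : ℝ) (f g : L2R) :
    inner ℂ (heat t f) g = inner ℂ f (heat t g) := by
  rw [← (Lp.fourierTransformₗᵢ ℝ ℂ).inner_map_map, fourier_heat, inner_expMul_left,
    ← fourier_heat, (Lp.fourierTransformₗᵢ ℝ ℂ).inner_map_map]

theorem continuous_heat (f : L2R) : Continuous fun t : ℝ => heat t f :=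
  (Lp.fourierTransformₗᵢ ℝ ℂ).symm.continuous.comp (continuous_expMul _ _)

theorem tendsto_heat_iff (f g : L2R) :
    Tendsto (fun t : ℝ≥0 => ((t : ℝ) : ℂ)⁻¹ • (f - heat t f)) (𝓝[≠] 0) (𝓝 g) ↔
      (f, g) ∈ freeHamiltonian.graph := by
  rw [mem_graph_freeHamiltonian_iff_fourier, ← tendsto_expMul_iff,
    (Lp.fourierTransformₗᵢ ℝ ℂ).isometry.isEmbedding.tendsto_nhds_iff]
  simp only [Function.comp_def, map_smul, map_sub, fourier_heat]

theorem exists_mem_graph_heat {t : ℝ} (ht : 0 < t) (f : L2R) :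
    ∃ g, (heat t f, g) ∈ freeHamiltonian.graph := by
  obtain ⟨g, hg⟩ := exists_coeFn_eq_mul_expMul kineticSymbol ht (Lp.fourierTransformₗᵢ ℝ ℂ f)
  refine ⟨(Lp.fourierTransformₗᵢ ℝ ℂ).symm g, ?_⟩
  rw [mem_graph_freeHamiltonian_iff_fourier, LinearIsometryEquiv.apply_symm_apply, fourier_heat]
  exact hg

theorem isClosed_graph_freeHamiltonian :
    IsClosed {p : L2R × L2R | p ∈ freeHamiltonian.graph} := by
  have := (isClosed_setOf_coeFn_eq_mul kineticSymbol).preimage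
    ((Lp.fourierTransformₗᵢ ℝ ℂ).continuous.prodMap (Lp.fourierTransformₗᵢ ℝ ℂ).continuous)
  convert this using 1
  ext ⟨f, g⟩
  exact mem_graph_freeHamiltonian_iff_fourier f g

/-! ### The potential -/

/-- The symbol `x² / 2` of the potential. -/
noncomputable def potentialSymbol : C(ℝ, ℝ≥0) :=
  ⟨fun x => Real.toNNReal (x ^ 2 / 2), by fun_prop⟩

theorem potentialSymbol_apply (x : ℝ) : (potentialSymbol x : ℝ) = x ^ 2 / 2 :=
  Real.coe_toNNReal _ (by positivity)

theorem mem_graph_potential_iff (f g : L2R) : (f, g) ∈ potential.graph ↔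
    g =ᵐ[volume] fun x => ((potentialSymbol x : ℝ) : ℂ) * f x := by
  simp only [potentialSymbol_apply]
  rw [LinearPMap.mem_graph_iff]
  constructor
  · rintro ⟨y, rfl, rfl⟩
    exact MemLp.coeFn_toLp (f := fun x => potentialFun x * y.1 x) y.2
  · intro h
    have hf : MemLp (fun x => potentialFun x * f x) 2 volume := (Lp.memLp g).ae_eq h
    refine ⟨⟨f, hf⟩, rfl, Lp.ext ?_⟩
    exact (MemLp.coeFn_toLp hf).trans h.symm

theorem isClosed_graph_potential : IsClosed {p : L2R × L2R | p ∈ potential.graph} := by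
  convert isClosed_setOf_coeFn_eq_mul potentialSymbol using 1
  ext ⟨f, g⟩
  exact mem_graph_potential_iff f g

theorem mem_graph_harmonicOscillator_iff (f g : L2R) : (f, g) ∈ harmonicOscillator.graph ↔
    ∃ u v, (f, u) ∈ freeHamiltonian.graph ∧ (f, v) ∈ potential.graph ∧ g = u + v := by
  rw [LinearPMap.mem_graph_iff]
  constructor
  · rintro ⟨y, rfl, rfl⟩
    exact ⟨freeHamiltonian ⟨y, y.2.1⟩, potential ⟨y, y.2.2⟩,
      freeHamiltonian.mem_graph ⟨y, y.2.1⟩, potential.mem_graph ⟨y, y.2.2⟩, rfl⟩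
  · rintro ⟨u, v, hu, hv, rfl⟩
    rw [LinearPMap.mem_graph_iff] at hu hv
    obtain ⟨⟨y, hy⟩, rfl, rfl⟩ := hu
    obtain ⟨⟨z, hz⟩, hzy, rfl⟩ := hv
    obtain rfl : z = y := hzy
    exact ⟨⟨z, hy, hz⟩, rfl, rfl⟩

/-- The semigroup `exp (-|a| V)`. -/
noncomputable abbrev expV (a : ℝ) : L2R →L[ℂ] L2R := expMul potentialSymbol a

theorem isExpNeg_potential : IsExpNeg potential fun t : ℝ≥0 => expV t where
  map_zero := expMul_zero _
  map_add s t := expMul_add _ s.2 t.2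
  strongly_continuous f := (continuous_expMul _ f).comp NNReal.continuous_coe
  generator f g := by rw [tendsto_expMul_iff, mem_graph_potential_iff]

theorem isExpNeg_freeHamiltonian : IsExpNeg freeHamiltonian fun t : ℝ≥0 => heat t where
  map_zero := heat_zero
  map_add s t := heat_add s.2 t.2
  strongly_continuous f := (continuous_heat f).comp NNReal.continuous_coe
  generator f g := (tendsto_heat_iff f g).symm

/-! ### Gaussians -/

theorem integrable_gaussian {β : ℝ} (hβ : 0 < β) (z : ℂ) :
    Integrable fun x : ℝ => Complex.exp (-(β / 2) * x ^ 2 + z * x) := by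
  have h : (-(β / 2 : ℂ)).re < 0 := by
    have : (-(β / 2 : ℂ)) = ((-(β / 2) : ℝ) : ℂ) := by push_cast; ring
    rw [this, Complex.ofReal_re]
    linarith
  simpa using integrable_cexp_quadratic' h z 0

theorem memLp_gaussian {β : ℝ} (hβ : 0 < β) (z : ℂ) :
    MemLp (fun x : ℝ => Complex.exp (-(β / 2) * x ^ 2 + z * x)) 2 volume := by
  rw [memLp_two_iff_integrable_sq_norm (by fun_prop)]
  refine ((integrable_gaussian (β := 2 * β) (by linarith) (2 * z.re)).norm).congr
    (.of_forall fun x => ?_)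
  simp only [Complex.norm_exp]
  rw [← Real.exp_nat_mul]
  congr 1
  simp [pow_two]
  ring

/-- The function `exp (-β x² / 2 + z x)` as an element of `L²(ℝ)` (and `0` if `β ≤ 0`). -/
noncomputable def gauss (β : ℝ) (z : ℂ) : L2R :=
  if h : 0 < β then (memLp_gaussian h z).toLp _ else 0

theorem coeFn_gauss {β : ℝ} (hβ : 0 < β) (z : ℂ) :
    gauss β z =ᵐ[volume] fun x : ℝ => Complex.exp (-(β / 2) * x ^ 2 + z * x) := by
  rw [gauss, dif_pos hβ]
  exact MemLp.coeFn_toLp _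

theorem expV_gauss {a β : ℝ} (ha : 0 ≤ a) (hβ : 0 < β) (z : ℂ) :
    expV a (gauss β z) = gauss (β + a) z := by
  refine Lp.ext ?_
  filter_upwards [coeFn_mulOp (expSymbol potentialSymbol a) (gauss β z), coeFn_gauss hβ z,
    coeFn_gauss (add_pos_of_pos_of_nonneg hβ ha) z] with x h1 h2 h3
  rw [expV, expMul, h1, h2, h3, expSymbol_apply, Complex.ofReal_exp, ← Complex.exp_add,
    potentialSymbol_apply, abs_of_nonneg ha]
  congr 1
  push_cast
  ring

theorem fourier_gauss {β : ℝ} (hβ : 0 < β) (z : ℂ) :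
    Lp.fourierTransformₗᵢ ℝ ℂ (gauss β z) =
      (((√(2 * Real.pi / β) : ℝ) : ℂ) * Complex.exp (z ^ 2 / (2 * β))) •
        gauss (4 * Real.pi ^ 2 / β) (-(2 * Real.pi * Complex.I * z / β)) := by
  have hβ' : (β : ℂ) ≠ 0 := by exact_mod_cast hβ.ne'
  have hπ : (Real.pi : ℂ) ≠ 0 := by exact_mod_cast Real.pi_ne_zero
  have h4 : 0 < 4 * Real.pi ^ 2 / β := by positivity
  have hb : ((β / (2 * Real.pi) : ℝ) : ℂ).re > 0 := by
    rw [Complex.ofReal_re]; positivity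
  have hF := fourier_gaussian_pi' hb (z / (2 * Real.pi))
  have h1 : (fun x : ℝ => Complex.exp (-Real.pi * ((β / (2 * Real.pi) : ℝ) : ℂ) * x ^ 2 +
      2 * Real.pi * (z / (2 * Real.pi)) * x)) =
      fun x : ℝ => Complex.exp (-(β / 2) * x ^ 2 + z * x) := by
    funext x
    congr 1
    push_cast
    field_simp
  rw [h1] at hF
  rw [gauss, dif_pos hβ]
  refine coeFn_fourier_toLp (integrable_gaussian hβ z) (memLp_gaussian hβ z) ?_
  rw [hF]
  filter_upwards [Lp.coeFn_smul (((√(2 * Real.pi / β) : ℝ) : ℂ) * Complex.exp (z ^ 2 / (2 * β)))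
    (gauss (4 * Real.pi ^ 2 / β) (-(2 * Real.pi * Complex.I * z / β))), coeFn_gauss h4 _]
    with x h2 h3
  have hs : (1 : ℂ) / ((β / (2 * Real.pi) : ℝ) : ℂ) ^ (1 / 2 : ℂ) =
      ((√(2 * Real.pi / β) : ℝ) : ℂ) := by
    have : ((1 / 2 : ℝ) : ℂ) = (1 / 2 : ℂ) := by push_cast; rfl
    rw [← this, ← Complex.ofReal_cpow (by positivity), ← Real.sqrt_eq_rpow,
      ← Complex.ofReal_one, ← Complex.ofReal_div, one_div, ← Real.sqrt_inv, inv_div]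
  rw [h2, Pi.smul_apply, h3, hs, smul_eq_mul, mul_assoc, ← Complex.exp_add]
  congr 2
  have hI := Complex.I_sq
  push_cast
  field_simp
  ring_nf
  rw [hI]
  ring

/-- In Fourier space the heat factor adds 4π²b to the parameter 4π²/β, so 1/β becomes 1/β + b. -/
theorem heat_gauss {b β : ℝ} (hb : 0 ≤ b) (hβ : 0 < β) (z : ℂ) :
    heat b (gauss β z) =
      (((√(1 + b * β) : ℝ) : ℂ)⁻¹ * Complex.exp (b * z ^ 2 / (2 * (1 + b * β)))) •
        gauss (β / (1 + b * β)) (z / (1 + b * β)) := by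
  have hβ' : (β : ℂ) ≠ 0 := by exact_mod_cast hβ.ne'
  have hd : 0 < 1 + b * β := by positivity
  have hd' : (1 + b * β : ℂ) ≠ 0 := by exact_mod_cast hd.ne'
  have hπ : (Real.pi : ℂ) ≠ 0 := by exact_mod_cast Real.pi_ne_zero
  have h4 : 0 < 4 * Real.pi ^ 2 / β := by positivity
  have h5 : 0 < β / (1 + b * β) := by positivity
  have h6 : 0 < 4 * Real.pi ^ 2 / (β / (1 + b * β)) := by positivity
  refine (Lp.fourierTransformₗᵢ ℝ ℂ).injective ?_
  rw [fourier_heat, map_smul, fourier_gauss hβ, fourier_gauss h5, map_smul]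
  have key : expMul kineticSymbol b
      (gauss (4 * Real.pi ^ 2 / β) (-(2 * Real.pi * Complex.I * z / β))) =
      gauss (4 * Real.pi ^ 2 / (β / (1 + b * β)))
        (-(2 * Real.pi * Complex.I * (z / (1 + b * β)) / ((β / (1 + b * β) : ℝ) : ℂ))) := by
    refine Lp.ext ?_
    filter_upwards [coeFn_mulOp (expSymbol kineticSymbol b) _, coeFn_gauss h4 _,
      coeFn_gauss h6 _] with x h1 h2 h3
    rw [expMul, h1, h2, h3, expSymbol_apply, Complex.ofReal_exp, ← Complex.exp_add,
      kineticSymbol_apply, abs_of_nonneg hb]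
    congr 1
    push_cast
    field_simp
    ring
  rw [key, smul_smul]
  congr 1
  have hs : √(2 * Real.pi / (β / (1 + b * β))) = √(2 * Real.pi / β) * √(1 + b * β) := by
    rw [← Real.sqrt_mul (by positivity)]
    congr 1
    field_simp
  have hs0 : ((√(1 + b * β) : ℝ) : ℂ) ≠ 0 := by
    exact_mod_cast (Real.sqrt_pos.2 hd).ne'
  rw [hs, Complex.ofReal_mul]
  have he : Complex.exp (z ^ 2 / (2 * β)) = Complex.exp (b * z ^ 2 / (2 * (1 + b * β))) *
      Complex.exp ((z / (1 + b * β)) ^ 2 / (2 * ((β / (1 + b * β) : ℝ) : ℂ))) := by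
    rw [← Complex.exp_add]
    congr 1
    have hd'' : (1 + β * b : ℂ) ≠ 0 := by rwa [mul_comm (β : ℂ)]
    push_cast
    field_simp
    ring
  rw [he]
  generalize ((√(1 + b * β) : ℝ) : ℂ) = r at *
  field_simp

theorem expV_injective {a : ℝ} (f : L2R) (h : expV a f = 0) : f = 0 := by
  refine Lp.ext ?_
  filter_upwards [coeFn_mulOp (expSymbol potentialSymbol a) f, Lp.coeFn_zero ℂ 2 (volume : Measure ℝ)]
    with x h1 h2
  rw [expV, expMul] at h
  rw [h, h2, expSymbol_apply] at h1
  rw [h2]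
  simpa using h1

/-- The Gaussians `exp (-β x² / 2 + i η x)`, `η ∈ ℝ`, are total in `L²(ℝ)`. -/
theorem eq_zero_of_inner_gauss_eq_zero {β : ℝ} (hβ : 0 < β) {f : L2R}
    (h : ∀ η : ℝ, inner ℂ (gauss β (η * Complex.I)) f = 0) : f = 0 := by
  refine expV_injective (a := β) f ?_
  have hcoe : expV β f =ᵐ[volume] fun x : ℝ => Complex.exp (-(β / 2) * x ^ 2 + 0 * x) * f x := by
    filter_upwards [coeFn_mulOp (expSymbol potentialSymbol β) f] with x h1
    rw [expV, expMul, h1, expSymbol_apply, Complex.ofReal_exp, potentialSymbol_apply,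
      abs_of_nonneg hβ.le]
    congr 2
    push_cast
    ring
  -- The inner products with the Gaussians are the values of the Fourier transform of e^(-βx²/2) f,
  -- which is integrable as a product of two L² functions. If they all vanish, so does this
  -- function.
  have hint : Integrable (expV β f) :=
    ((memLp_gaussian hβ 0).integrable_mul (Lp.memLp f)).congr hcoe.symm
  have hF := coeFn_fourier_toLp hint (Lp.memLp (expV β f)) (g := 0) ?_
  · rw [Lp.toLp_coeFn] at hF
    exact (map_eq_zero_iff _ (Lp.fourierTransformₗᵢ ℝ ℂ).injective).1 hF
  filter_upwards [Lp.coeFn_zero ℂ 2 (volume : Measure ℝ)] with w hw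
  rw [hw, Real.fourier_real_eq_integral_exp_smul, Pi.zero_apply, ← h (2 * Real.pi * w : ℝ),
    L2.inner_def]
  refine integral_congr_ae ?_
  filter_upwards [hcoe, coeFn_gauss hβ ((2 * Real.pi * w : ℝ) * Complex.I)] with x h1 h2
  rw [h1, h2, RCLike.inner_apply, ← Complex.exp_conj, smul_eq_mul, ← mul_assoc,
    ← Complex.exp_add, mul_comm (f x)]
  congr 2
  have h2 : starRingEnd ℂ 2 = 2 := Complex.conj_ofNat 2
  simp [h2]
  ring

theorem span_gauss_eq_top {β : ℝ} (hβ : 0 < β) :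
    (Submodule.span ℂ (Set.range fun η : ℝ => gauss β (η * Complex.I))).topologicalClosure = ⊤ := by
  rw [Submodule.topologicalClosure_eq_top_iff, Submodule.eq_bot_iff]
  intro f hf
  refine eq_zero_of_inner_gauss_eq_zero hβ fun η => ?_
  exact (Submodule.mem_orthogonal _ f).1 hf _ (Submodule.subset_span ⟨η, rfl⟩)

/-- Reduces an identity between bounded operators to an explicit computation on Gaussians of one
fixed width. -/
theorem eq_of_forall_gauss_eq {β : ℝ} (hβ : 0 < β) {A B : L2R →L[ℂ] L2R}
    (h : ∀ η : ℝ, A (gauss β (η * Complex.I)) = B (gauss β (η * Complex.I))) : A = B := by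
  refine ContinuousLinearMap.ext_on
    (Submodule.dense_iff_topologicalClosure_eq_top.2 (span_gauss_eq_top hβ)) ?_
  · rintro _ ⟨η, rfl⟩
    exact h η

/-! ### The oscillator semigroup in product form -/

/-- The operator `exp (-s H_ω)`, `s ≥ 0`, where `H_ω = ω⁻¹ H₀ + ω V`, in the product form
`exp (-ω tanh (s / 2) V) exp (-ω⁻¹ sinh s H₀) exp (-ω tanh (s / 2) V)`. -/
noncomputable def oscSemigroup (ω s : ℝ) : L2R →L[ℂ] L2R :=
  expV (ω * (Real.sinh (s / 2) / Real.cosh (s / 2))) * heat (Real.sinh s / ω) *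
    expV (ω * (Real.sinh (s / 2) / Real.cosh (s / 2)))

theorem oscSemigroup_zero (ω : ℝ) : oscSemigroup ω 0 = 1 := by
  simp [oscSemigroup, expV, expMul_zero, heat_zero]

theorem exp_eq_sq_half (s : ℝ) :
    Real.exp s = (Real.sinh (s / 2) + Real.cosh (s / 2)) ^ 2 := by
  rw [Real.sinh_add_cosh, ← Real.exp_nat_mul]
  congr 1
  push_cast
  ring

theorem sinh_eq_half (s : ℝ) : Real.sinh s = 2 * Real.sinh (s / 2) * Real.cosh (s / 2) := by
  rw [← Real.sinh_two_mul]
  congr 1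
  ring

theorem sinh_mul_exp_neg (s : ℝ) :
    Real.sinh s * Real.exp (-s) = (1 - Real.exp (-(2 * s))) / 2 := by
  rw [Real.sinh_eq, sub_div, sub_mul, div_mul_eq_mul_div, div_mul_eq_mul_div, ← Real.exp_add,
    ← Real.exp_add]
  ring_nf
  simp

/-- The action of the oscillator semigroup on Gaussians. -/
theorem oscSemigroup_gauss {ω s : ℝ} (hω : 0 < ω) (hs : 0 ≤ s) (z : ℂ) :
    oscSemigroup ω s (gauss ω z) =
      ((Real.exp (-s / 2) : ℝ) * Complex.exp (((1 - Real.exp (-(2 * s))) / (4 * ω) : ℝ) * z ^ 2)) •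
        gauss ω ((Real.exp (-s) : ℝ) * z) := by
  have hx : 0 ≤ Real.sinh (s / 2) := Real.sinh_nonneg_iff.2 (by linarith)
  have hy : 0 < Real.cosh (s / 2) := Real.cosh_pos _
  have hyx := Real.cosh_sq (s / 2)
  have he := exp_eq_sq_half s
  have hsh := sinh_eq_half s
  have he2 : Real.exp (-s / 2) = (Real.sinh (s / 2) + Real.cosh (s / 2))⁻¹ := by
    rw [Real.sinh_add_cosh, ← Real.exp_neg]
    ring_nf
  rw [← div_div, show (1 - Real.exp (-(2 * s))) / 4 = Real.sinh s * Real.exp (-s) / 2 by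
    rw [sinh_mul_exp_neg]; ring, Real.exp_neg, he2, oscSemigroup, he, hsh]
  set x := Real.sinh (s / 2)
  set y := Real.cosh (s / 2)
  -- With y² = x² + 1, the three factors change the Gaussian parameter from ω to ω(1 + x/y), then
  -- divide it by (x+y)² = e^s, then add ωx/y, which returns exactly ω. This invariance dictates the
  -- coefficients in the product.
  have hT : 0 ≤ ω * (x / y) := by positivity
  have hb : 0 ≤ 2 * x * y / ω := by positivity
  have hβ : 0 < ω + ω * (x / y) := by positivity
  have hβ' : 1 + 2 * x * y / ω * (ω + ω * (x / y)) = (x + y) ^ 2 := by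
    field_simp
    linear_combination -hyx
  have hβ2 : (ω + ω * (x / y)) / (x + y) ^ 2 + ω * (x / y) = ω := by
    field_simp
    linear_combination -(x + y) * hyx
  have hpos : 0 < (ω + ω * (x / y)) / (x + y) ^ 2 := by positivity
  have hβc : (1 : ℂ) + ((2 * x * y / ω : ℝ) : ℂ) * ((ω + ω * (x / y) : ℝ) : ℂ) =
      (((x + y) ^ 2 : ℝ) : ℂ) := by
    rw [← hβ']
    push_cast
    rfl
  rw [mul_apply_eq_comp, mul_apply_eq_comp, expV_gauss hT hω,
    heat_gauss hb hβ, map_smul, hβc, hβ', expV_gauss hT hpos, hβ2, Real.sqrt_sq (by positivity)]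
  congr 1
  · rw [Complex.ofReal_inv]
    congr 2
    have hxy : (x + y : ℂ) ≠ 0 := by
      have : x + y ≠ 0 := by positivity
      exact_mod_cast this
    push_cast
    field_simp
  · congr 1
    push_cast
    ring

theorem oscSemigroup_add {ω s t : ℝ} (hω : 0 < ω) (hs : 0 ≤ s) (ht : 0 ≤ t) :
    oscSemigroup ω (s + t) = oscSemigroup ω s * oscSemigroup ω t := by
  refine eq_of_forall_gauss_eq hω fun η => ?_
  rw [mul_apply_eq_comp, oscSemigroup_gauss hω (add_nonneg hs ht),
    oscSemigroup_gauss hω ht, map_smul, oscSemigroup_gauss hω hs, smul_smul]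
  congr 1
  · have h1 : Real.exp (-(s + t) / 2) = Real.exp (-s / 2) * Real.exp (-t / 2) := by
      rw [← Real.exp_add]; ring_nf
    have h2 : Real.exp (-(2 * (s + t))) = Real.exp (-(2 * s)) * Real.exp (-t) ^ 2 := by
      rw [← Real.exp_nat_mul, ← Real.exp_add]; push_cast; ring_nf
    have h3 : Real.exp (-(2 * t)) = Real.exp (-t) ^ 2 := by
      rw [← Real.exp_nat_mul]; push_cast; ring_nf
    rw [h1, mul_mul_mul_comm, ← Complex.exp_add, ← Complex.ofReal_mul, mul_comm (Real.exp (-t / 2)),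
      h2, h3]
    congr 2
    push_cast
    ring
  · congr 1
    rw [neg_add, Real.exp_add]
    push_cast
    ring

theorem oscSemigroup_nat_mul {ω s : ℝ} (hω : 0 < ω) (hs : 0 ≤ s) (n : ℕ) :
    oscSemigroup ω (n * s) = oscSemigroup ω s ^ n := by
  induction n with
  | zero => simp [oscSemigroup_zero]
  | succ n ih =>
    rw [Nat.cast_succ, add_mul, one_mul, oscSemigroup_add hω (by positivity) hs, ih, pow_succ]

/-- A second product form of the semigroup `exp (-s H)`. -/
theorem oscSemigroup_one_eq_heat_mul {s : ℝ} (hs : 0 ≤ s) :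
    oscSemigroup 1 s = heat (Real.sinh (s / 2) / Real.cosh (s / 2)) * expV (Real.sinh s) *
      heat (Real.sinh (s / 2) / Real.cosh (s / 2)) := by
  refine eq_of_forall_gauss_eq one_pos fun η => ?_
  rw [oscSemigroup_gauss one_pos hs]
  generalize (η * Complex.I : ℂ) = z
  have hx : 0 ≤ Real.sinh (s / 2) := Real.sinh_nonneg_iff.2 (by linarith)
  have hy : 0 < Real.cosh (s / 2) := Real.cosh_pos _
  have hyx := Real.cosh_sq (s / 2)
  have he := exp_eq_sq_half s
  have hsh := sinh_eq_half s
  have he2 : Real.exp (-s / 2) = (Real.sinh (s / 2) + Real.cosh (s / 2))⁻¹ := by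
    rw [Real.sinh_add_cosh, ← Real.exp_neg]
    ring_nf
  rw [mul_one, show (1 - Real.exp (-(2 * s))) / 4 = Real.sinh s * Real.exp (-s) / 2 by
    rw [sinh_mul_exp_neg]; ring, Real.exp_neg, he2, he, hsh]
  set x := Real.sinh (s / 2)
  set y := Real.cosh (s / 2)
  -- The Gaussian parameter runs 1, y/(x+y), y(x+y), 1, again by y² = x² + 1.
  have hT : 0 ≤ x / y := by positivity
  have hb : 0 ≤ 2 * x * y := by positivity
  have hβ : 0 < 1 / (1 + x / y * 1) := by positivity
  have hβ2 : 1 / (1 + x / y * 1) + 2 * x * y = y * (x + y) := by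
    field_simp
    linear_combination -hyx
  have hβ3 : 0 < y * (x + y) := by positivity
  have hβ4 : 1 + x / y * (y * (x + y)) = y * (x + y) := by
    field_simp
    linear_combination -hyx
  have hβc : (1 : ℂ) + ((x / y : ℝ) : ℂ) * ((y * (x + y) : ℝ) : ℂ) = ((y * (x + y) : ℝ) : ℂ) := by
    rw [← Complex.ofReal_mul, ← Complex.ofReal_one, ← Complex.ofReal_add, hβ4]
  rw [mul_apply_eq_comp, mul_apply_eq_comp, heat_gauss hT one_pos,
    map_smul, expV_gauss hb hβ, hβ2, map_smul, heat_gauss hT hβ3, smul_smul, hβ4, hβc,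
    div_self hβ3.ne']
  have hyc : (y : ℂ) ≠ 0 := by exact_mod_cast hy.ne'
  have hxy : (x + y : ℂ) ≠ 0 := by
    have : x + y ≠ 0 := by positivity
    exact_mod_cast this
  have hyx' : (y : ℂ) ^ 2 = x ^ 2 + 1 := by exact_mod_cast hyx
  have h1 : (1 : ℂ) + ((x / y : ℝ) : ℂ) * ((1 : ℝ) : ℂ) = (x + y) / y := by
    push_cast
    field_simp
    ring
  rw [h1]
  congr 1
  · have hsq : √(1 + x / y * 1) * √(y * (x + y)) = x + y := by
      rw [← Real.sqrt_mul (by positivity), ← Real.sqrt_sq (by positivity : 0 ≤ x + y)]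
      congr 1
      rw [Real.sqrt_sq (by positivity)]
      field_simp
      ring
    rw [mul_mul_mul_comm, ← Complex.exp_add, ← mul_inv, ← Complex.ofReal_mul, hsq,
      Complex.ofReal_inv]
    congr 2
    push_cast
    field_simp
    linear_combination (x * z ^ 2 : ℂ) * hyx'
  · congr 1
    push_cast
    field_simp

theorem norm_mul_mul_le {A : Type*} [NormedRing A] {a b c : A} {r : ℝ} (ha : ‖a‖ ≤ 1)
    (hb : ‖b‖ ≤ r) (hc : ‖c‖ ≤ 1) : ‖a * b * c‖ ≤ r := by
  have hr : 0 ≤ r := (norm_nonneg b).trans hb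
  calc ‖a * b * c‖ ≤ ‖a‖ * ‖b‖ * ‖c‖ := norm_mul₃_le
    _ ≤ 1 * r * 1 := by gcongr
    _ = r := by ring

theorem norm_oscSemigroup_le_one (ω s : ℝ) : ‖oscSemigroup ω s‖ ≤ 1 :=
  norm_mul_mul_le (norm_expMul_le _ _) (norm_heat_le _) (norm_expMul_le _ _)

theorem inner_oscSemigroup_left (ω s : ℝ) (f g : L2R) :
    inner ℂ (oscSemigroup ω s f) g = inner ℂ f (oscSemigroup ω s g) := by
  simp only [oscSemigroup, mul_apply_eq_comp, inner_expMul_left, inner_heat_left]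

theorem isSelfAdjoint_oscSemigroup (ω s : ℝ) : IsSelfAdjoint (oscSemigroup ω s) :=
  ContinuousLinearMap.isSelfAdjoint_iff_isSymmetric.2 fun f g => inner_oscSemigroup_left ω s f g

/-- Changing the frequency changes the semigroup by `O(ω - 1)`. -/
theorem norm_oscSemigroup_sub_le_freq {ω s : ℝ} (hω : 1 ≤ ω) (hs : 0 ≤ s) :
    ‖oscSemigroup ω s - oscSemigroup 1 s‖ ≤ 3 * (ω - 1) := by
  rcases hs.eq_or_lt with rfl | hs
  · simp [oscSemigroup_zero]
    linarith
  have hω0 : 0 < ω := by linarith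
  have hx : 0 < Real.sinh (s / 2) := Real.sinh_pos_iff.2 (by linarith)
  have hb : 0 < Real.sinh s := Real.sinh_pos_iff.2 hs
  have hy : 0 < Real.cosh (s / 2) := Real.cosh_pos _
  simp only [oscSemigroup, one_mul, div_one]
  have ha : 0 < Real.sinh (s / 2) / Real.cosh (s / 2) := by positivity
  generalize Real.sinh (s / 2) / Real.cosh (s / 2) = a at *
  generalize Real.sinh s = b at *
  have h1 : ‖expV (ω * a) - expV a‖ ≤ ω - 1 := by
    rw [norm_sub_rev]
    refine (norm_expMul_sub_le _ ha (le_mul_of_one_le_left ha.le hω)).trans_eq ?_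
    field_simp
  have h2 : ‖heat (b / ω) - heat b‖ ≤ ω - 1 := by
    refine (norm_heat_sub_le (by positivity) (div_le_self hb.le hω)).trans_eq ?_
    field_simp
  -- Telescoping over the three factors. Each one changes by at most ω - 1, since its times differ
  -- by the ratio ω.
  have e : expV (ω * a) * heat (b / ω) * expV (ω * a) - expV a * heat b * expV a =
      1 * (expV (ω * a) - expV a) * (heat (b / ω) * expV (ω * a)) +
      expV a * (heat (b / ω) - heat b) * expV (ω * a) +
      (expV a * heat b) * (expV (ω * a) - expV a) * 1 := by noncomm_ring
  have hE := norm_expMul_le potentialSymbol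
  have hm : ∀ {p q : L2R →L[ℂ] L2R}, ‖p‖ ≤ 1 → ‖q‖ ≤ 1 → ‖p * q‖ ≤ 1 := fun hp hq =>
    (norm_mul_le _ _).trans (mul_le_one₀ hp (norm_nonneg _) hq)
  have h1' : ‖(1 : L2R →L[ℂ] L2R)‖ ≤ 1 := ContinuousLinearMap.norm_id_le
  rw [e]
  calc _ ≤ _ := norm_add₃_le
    _ ≤ (ω - 1) + (ω - 1) + (ω - 1) := by
      gcongr
      · exact norm_mul_mul_le h1' h1 (hm (norm_heat_le _) (hE _))
      · exact norm_mul_mul_le (hE _) h2 (hE _)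
      · exact norm_mul_mul_le (hm (hE _) (norm_heat_le _)) h1 h1'
    _ = 3 * (ω - 1) := by ring

/-- One step of the symmetric product formula is an oscillator semigroup. -/
theorem expV_mul_heat_mul_expV_eq (u : ℝ) :
    expV u * heat (2 * u) * expV u = oscSemigroup (√(1 + u ^ 2)) (2 * Real.arsinh u) := by
  have hpos : 0 < √(1 + u ^ 2) := Real.sqrt_pos.2 (by positivity)
  rw [oscSemigroup, Real.sinh_two_mul, mul_div_cancel_left₀ _ two_ne_zero, Real.sinh_arsinh,
    Real.cosh_arsinh, mul_div_cancel_right₀ _ hpos.ne', mul_div_cancel₀ _ hpos.ne']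

/-! ### Norms of self-adjoint operators -/

/-- A self-adjoint operator is bounded by `ρ` if its powers grow at most like `ρ ^ m` on a dense
set. -/
theorem opNorm_le_of_norm_pow_apply_le {E : Type*} [NormedAddCommGroup E] [InnerProductSpace ℂ E]
    {B : E →L[ℂ] E} (hB : ∀ f g, inner ℂ (B f) g = inner ℂ f (B g)) {ρ : ℝ} (hρ : 0 < ρ)
    {D : Set E} (hD : Dense D) (h : ∀ f ∈ D, ∃ C, ∀ m : ℕ, ‖(B ^ m) f‖ ≤ C * ρ ^ m) :
    ‖B‖ ≤ ρ := by
  refine ContinuousLinearMap.opNorm_le_bound _ hρ.le fun f => ?_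
  refine hD.induction (P := fun f => ‖B f‖ ≤ ρ * ‖f‖) (fun f hf => ?_)
    (isClosed_le (by fun_prop) (by fun_prop)) f
  obtain ⟨C, hC⟩ := h f hf
  set a : ℕ → ℝ := fun m => ‖(B ^ m) f‖ with ha
  have a0 : ∀ m, 0 ≤ a m := fun m => norm_nonneg _
  have hS : ∀ m, (B ^ (m + 1)) f = B ((B ^ m) f) := fun m => by rw [pow_succ']; rfl
  -- Symmetry and Cauchy–Schwarz make m ↦ ‖B^m f‖ log-convex. Its successive ratios then increase,
  -- so ‖B^m f‖ grows at least like (‖B f‖/‖f‖)^m, which is incompatible with growth ρ^m unless ‖B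
  -- f‖ ≤ ρ‖f‖.
  have hconv : ∀ m, a (m + 1) ^ 2 ≤ a m * a (m + 2) := by
    intro m
    have h1 : ‖(B ^ (m + 1)) f‖ ^ 2 = ‖(inner ℂ ((B ^ m) f) ((B ^ (m + 2)) f) : ℂ)‖ := by
      rw [hS (m + 1), ← hB, ← hS, inner_self_eq_norm_sq_to_K]
      simp
    simp only [ha, h1]
    exact norm_inner_le_norm _ _
  have h1 : ∀ m, a 1 * a m ≤ a 0 * a (m + 1) := by
    intro m
    induction m with
    | zero => rw [mul_comm]
    | succ m ih =>
      rcases (a0 m).eq_or_lt with h0 | h0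
      · have := hconv m
        rw [← h0, zero_mul] at this
        have : a (m + 1) = 0 := by nlinarith
        rw [this, mul_zero]
        exact mul_nonneg (a0 _) (a0 _)
      · refine le_of_mul_le_mul_right ?_ h0
        calc a 1 * a (m + 1) * a m = a 1 * a m * a (m + 1) := by ring
          _ ≤ a 0 * a (m + 1) * a (m + 1) := by gcongr
          _ = a 0 * a (m + 1) ^ 2 := by ring
          _ ≤ a 0 * (a m * a (m + 2)) := mul_le_mul_of_nonneg_left (hconv m) (a0 0)
          _ = a 0 * a (m + 1 + 1) * a m := by ring
  have h2 : ∀ m, a 1 ^ m * a 0 ≤ a 0 ^ m * a m := by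
    intro m
    induction m with
    | zero => simp
    | succ m ih =>
      calc a 1 ^ (m + 1) * a 0 = a 1 * (a 1 ^ m * a 0) := by ring
        _ ≤ a 1 * (a 0 ^ m * a m) := by gcongr
        _ = a 0 ^ m * (a 1 * a m) := by ring
        _ ≤ a 0 ^ m * (a 0 * a (m + 1)) :=
          mul_le_mul_of_nonneg_left (h1 m) (pow_nonneg (a0 0) m)
        _ = a 0 ^ (m + 1) * a (m + 1) := by ring
  have e0 : a 0 = ‖f‖ := by simp [ha]
  have e1 : a 1 = ‖B f‖ := by simp [ha]
  rw [← e0, ← e1]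
  by_contra! hlt
  rcases (a0 0).eq_or_lt with h0 | h0
  · have : f = 0 := by rw [← norm_eq_zero, ← e0, ← h0]
    rw [e1, this, map_zero, norm_zero, ← h0, mul_zero] at hlt
    exact hlt.false
  · have hq : 1 < a 1 / (ρ * a 0) := (one_lt_div (by positivity)).2 hlt
    obtain ⟨m, hm⟩ := pow_unbounded_of_one_lt (C / a 0) hq
    refine hm.not_ge ?_
    rw [div_pow, div_le_div_iff₀ (by positivity) h0]
    calc a 1 ^ m * a 0 ≤ a 0 ^ m * a m := h2 m
      _ ≤ a 0 ^ m * (C * ρ ^ m) := by gcongr; exact hC m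
      _ = C * (ρ * a 0) ^ m := by ring

theorem norm_gauss_mul_I {β : ℝ} (hβ : 0 < β) (η : ℝ) :
    ‖gauss β (η * Complex.I)‖ = ‖gauss β 0‖ := by
  have key : ∀ᵐ x, ‖gauss β (η * Complex.I) x‖ = ‖gauss β 0 x‖ := by
    filter_upwards [coeFn_gauss hβ (η * Complex.I), coeFn_gauss hβ 0] with x h1 h2
    rw [h1, h2, Complex.norm_exp, Complex.norm_exp]
    congr 1
    simp
  exact le_antisymm (Lp.norm_le_norm_of_ae_le (key.mono fun x hx => hx.le))
    (Lp.norm_le_norm_of_ae_le (key.mono fun x hx => hx.ge))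

theorem gauss_ne_zero {β : ℝ} (hβ : 0 < β) (z : ℂ) : gauss β z ≠ 0 := by
  intro h
  have h1 := coeFn_gauss hβ z
  rw [h] at h1
  obtain ⟨x, hx1, hx2⟩ := (h1.and (Lp.coeFn_zero ℂ 2 (volume : Measure ℝ))).exists
  rw [hx2] at hx1
  exact Complex.exp_ne_zero _ hx1.symm

/-- For z = iη the scalar factor exp(k z²) with k ≥ 0 is at most 1, and the imaginary exponent is
only a phase, so just the ground state decay e^(-s/2) remains. -/
theorem norm_oscSemigroup_gauss_le {ω s : ℝ} (hω : 0 < ω) (hs : 0 ≤ s) (η : ℝ) :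
    ‖oscSemigroup ω s (gauss ω (η * Complex.I))‖ ≤ ‖gauss ω 0‖ * Real.exp (-s / 2) := by
  have hk : 0 ≤ (1 - Real.exp (-(2 * s))) / (4 * ω) := by
    have : Real.exp (-(2 * s)) ≤ 1 := Real.exp_le_one_iff.2 (by linarith)
    exact div_nonneg (by linarith) (by positivity)
  rw [oscSemigroup_gauss hω hs, norm_smul, ← mul_assoc, ← Complex.ofReal_mul, norm_gauss_mul_I hω,
    norm_mul, Complex.norm_exp, Complex.norm_real, Real.norm_of_nonneg (Real.exp_pos _).le,
    mul_comm ‖gauss ω 0‖]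
  refine mul_le_mul_of_nonneg_right (mul_le_of_le_one_right (Real.exp_pos _).le ?_) (norm_nonneg _)
  rw [Real.exp_le_one_iff, mul_pow, Complex.I_sq, ← Complex.ofReal_pow, mul_neg_one,
    ← Complex.ofReal_neg, ← Complex.ofReal_mul, Complex.ofReal_re]
  nlinarith [sq_nonneg η]

/-- The m-th power is the semigroup at time ms, which decays like e^(-ms/2) on the dense span of
Gaussians; symmetry turns this into a norm bound. -/
theorem norm_oscSemigroup_le {ω s : ℝ} (hω : 0 < ω) (hs : 0 ≤ s) :
    ‖oscSemigroup ω s‖ ≤ Real.exp (-s / 2) := by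
  refine opNorm_le_of_norm_pow_apply_le (inner_oscSemigroup_left ω s) (Real.exp_pos _)
    (Submodule.dense_iff_topologicalClosure_eq_top.2 (span_gauss_eq_top hω)) fun f hf => ?_
  induction hf using Submodule.span_induction with
  | mem f hf =>
    obtain ⟨η, rfl⟩ := hf
    refine ⟨‖gauss ω 0‖, fun m => ?_⟩
    rw [← oscSemigroup_nat_mul hω hs, ← Real.exp_nat_mul]
    refine (norm_oscSemigroup_gauss_le hω (by positivity) η).trans_eq ?_
    ring_nf
  | zero => exact ⟨0, fun m => by simp⟩
  | add f g _ _ hf hg =>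
    obtain ⟨C, hC⟩ := hf
    obtain ⟨C', hC'⟩ := hg
    refine ⟨C + C', fun m => ?_⟩
    rw [map_add, add_mul]
    exact (norm_add_le _ _).trans (add_le_add (hC m) (hC' m))
  | smul c f _ hf =>
    obtain ⟨C, hC⟩ := hf
    refine ⟨‖c‖ * C, fun m => ?_⟩
    rw [map_smul, norm_smul, mul_assoc]
    gcongr
    exact hC m

/-- The ground state shows that the bound `exp (-s / 2)` is attained. -/
theorem le_norm_oscSemigroup {ω s : ℝ} (hω : 0 < ω) (hs : 0 ≤ s) :
    Real.exp (-s / 2) ≤ ‖oscSemigroup ω s‖ := by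
  have h := (oscSemigroup ω s).le_opNorm (gauss ω 0)
  rw [oscSemigroup_gauss hω hs, norm_smul, mul_zero] at h
  simp only [ne_eq, OfNat.ofNat_ne_zero, not_false_eq_true, zero_pow, mul_zero, Complex.exp_zero,
    mul_one, Complex.norm_real, Real.norm_of_nonneg (Real.exp_pos _).le] at h
  exact le_of_mul_le_mul_right h (norm_pos_iff.2 (gauss_ne_zero hω 0))

/-- By the functional calculus it suffices to bound y^m (1-y) for y = x² in [0,1]; there (m+1) y^m
(1-y) ≤ 1 - y^(m+1) ≤ 1. Even powers make positivity of b unnecessary. -/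
theorem norm_pow_sub_pow_le {A : Type*} [CStarAlgebra A] {b : A} (hb : IsSelfAdjoint b)
    (h1 : ‖b‖ ≤ 1) (m : ℕ) : ‖b ^ (2 * m) - b ^ (2 * m + 2)‖ ≤ 1 / (m + 1) := by
  have e : b ^ (2 * m) - b ^ (2 * m + 2) =
      cfc (fun x : ℝ => x ^ (2 * m) - x ^ (2 * m + 2)) b := by
    rw [cfc_sub (fun x : ℝ => x ^ (2 * m)) (fun x : ℝ => x ^ (2 * m + 2)) b,
      cfc_pow_id b (2 * m), cfc_pow_id b (2 * m + 2)]
  rw [e]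
  refine norm_cfc_le (by positivity) fun x hx => ?_
  have hx1 : ‖x‖ ≤ 1 := by
    rcases subsingleton_or_nontrivial A with h | h
    · simp [spectrum.of_subsingleton] at hx
    · exact (spectrum.norm_le_norm_of_mem hx).trans h1
  have hx2 : x ^ 2 ≤ 1 := by rwa [sq_le_one_iff_abs_le_one]
  have hx0 : 0 ≤ x ^ 2 := sq_nonneg x
  rw [pow_add, pow_mul]
  generalize x ^ 2 = y at *
  have hsum : (m + 1 : ℝ) * y ^ m ≤ ∑ i ∈ Finset.range (m + 1), y ^ i := by
    have := Finset.card_nsmul_le_sum (Finset.range (m + 1)) (fun i => y ^ i) (y ^ m) fun i hi =>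
      pow_le_pow_of_le_one hx0 hx2 (Nat.lt_succ_iff.1 (Finset.mem_range.1 hi))
    simpa using this
  have hgeom : (∑ i ∈ Finset.range (m + 1), y ^ i) * (1 - y) = 1 - y ^ (m + 1) := by
    have := geom_sum_mul_neg y (m + 1)
    exact this
  have hp : 0 ≤ y ^ m := by positivity
  have hp' : 0 ≤ y ^ (m + 1) := by positivity
  rw [Real.norm_of_nonneg (by nlinarith), le_div_iff₀ (by positivity)]
  calc (y ^ m - y ^ m * y) * (m + 1) = ((m + 1) * y ^ m) * (1 - y) := by ring
    _ ≤ (∑ i ∈ Finset.range (m + 1), y ^ i) * (1 - y) := by gcongr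
    _ ≤ 1 := by rw [hgeom]; linarith

theorem norm_oscSemigroup_sub_le_time {ω s t : ℝ} (hω : 0 < ω) (hs : 0 < s) (hst : s ≤ t) :
    ‖oscSemigroup ω s - oscSemigroup ω t‖ ≤ (t - s) / s := by
  rcases hst.eq_or_lt with rfl | hst
  · simp
  set δ := t - s with hδ
  have hδ0 : 0 < δ := sub_pos.2 hst
  -- With B the semigroup at time δ/2, both operators are the contraction at time s - mδ times
  -- B^(2m) and B^(2m+2) respectively. The choice of m gives 1/(m+1) ≤ δ/s.
  set m := ⌊s / δ⌋₊ with hm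
  have hm1 : m * δ ≤ s := by
    rw [← le_div_iff₀ hδ0]
    exact Nat.floor_le (by positivity)
  have hm2 : s / δ < m + 1 := Nat.lt_floor_add_one _
  set B := oscSemigroup ω (δ / 2) with hB
  have hp : ∀ k : ℕ, oscSemigroup ω (k * (δ / 2)) = B ^ k := fun k =>
    oscSemigroup_nat_mul hω (by positivity) k
  have e1 : oscSemigroup ω s = oscSemigroup ω (s - m * δ) * B ^ (2 * m) := by
    rw [← hp, ← oscSemigroup_add hω (by linarith) (by positivity)]
    congr 1
    push_cast
    ring
  have e2 : oscSemigroup ω t = oscSemigroup ω (s - m * δ) * B ^ (2 * m + 2) := by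
    rw [← hp, ← oscSemigroup_add hω (by linarith) (by positivity)]
    congr 1
    push_cast
    rw [hδ]
    ring
  rw [e1, e2, ← mul_sub]
  calc _ ≤ ‖oscSemigroup ω (s - m * δ)‖ * ‖B ^ (2 * m) - B ^ (2 * m + 2)‖ := norm_mul_le _ _
    _ ≤ 1 * (1 / (m + 1)) := by
      gcongr
      · exact norm_oscSemigroup_le_one _ _
      · exact norm_pow_sub_pow_le (isSelfAdjoint_oscSemigroup ω _) (norm_oscSemigroup_le_one _ _) m
    _ ≤ δ / s := by
      rw [one_mul, div_le_div_iff₀ (by positivity) hs]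
      rw [div_lt_iff₀ hδ0] at hm2
      linarith

theorem norm_sq_sub_sq_le {A : Type*} [NormedRing A] {a b : A} {r d : ℝ} (ha : ‖a‖ ≤ r)
    (hb : ‖b‖ ≤ r) (hd : ‖a - b‖ ≤ d) : ‖a * a - b * b‖ ≤ 2 * r * d := by
  have hr : 0 ≤ r := (norm_nonneg a).trans ha
  have e : a * a - b * b = a * (a - b) + (a - b) * b := by noncomm_ring
  rw [e]
  calc _ ≤ ‖a‖ * ‖a - b‖ + ‖a - b‖ * ‖b‖ :=
        (norm_add_le _ _).trans (add_le_add (norm_mul_le _ _) (norm_mul_le _ _))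
    _ ≤ r * d + d * r := by gcongr; exact (norm_nonneg _).trans hd
    _ = 2 * r * d := by ring

theorem oscSemigroup_half_mul_half {ω s : ℝ} (hω : 0 < ω) (hs : 0 ≤ s) :
    oscSemigroup ω s = oscSemigroup ω (s / 2) * oscSemigroup ω (s / 2) := by
  rw [← oscSemigroup_add hω (by linarith) (by linarith), add_halves]

/-- Perturbation of frequency and time, with exponential decay. -/
theorem norm_oscSemigroup_sub_le {ω s t : ℝ} (hω : 1 ≤ ω) (hs : 0 < s) (hst : s ≤ t) :
    ‖oscSemigroup ω s - oscSemigroup 1 t‖ ≤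
      Real.exp (-s / 4) * (6 * (ω - 1) + 2 * ((t - s) / s)) := by
  have hω0 : 0 < ω := by linarith
  have hd : ∀ {ω' r : ℝ}, 0 < ω' → s ≤ r → ‖oscSemigroup ω' (r / 2)‖ ≤ Real.exp (-s / 4) :=
    fun h hr => (norm_oscSemigroup_le h (by linarith)).trans (Real.exp_le_exp.2 (by linarith))
  have h1 : ‖oscSemigroup ω s - oscSemigroup 1 s‖ ≤ 2 * Real.exp (-s / 4) * (3 * (ω - 1)) := by
    rw [oscSemigroup_half_mul_half hω0 hs.le, oscSemigroup_half_mul_half one_pos hs.le]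
    exact norm_sq_sub_sq_le (hd hω0 le_rfl) (hd one_pos le_rfl)
      (norm_oscSemigroup_sub_le_freq hω (by linarith))
  have h2 : ‖oscSemigroup 1 s - oscSemigroup 1 t‖ ≤ 2 * Real.exp (-s / 4) * ((t - s) / s) := by
    rw [oscSemigroup_half_mul_half one_pos hs.le,
      oscSemigroup_half_mul_half one_pos (hs.le.trans hst)]
    refine norm_sq_sub_sq_le (hd one_pos le_rfl) (hd one_pos hst)
      ((norm_oscSemigroup_sub_le_time one_pos (by linarith) (by linarith)).trans_eq ?_)
    field_simp
  calc _ ≤ ‖oscSemigroup ω s - oscSemigroup 1 s‖ + ‖oscSemigroup 1 s - oscSemigroup 1 t‖ :=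
        norm_sub_le_norm_sub_add_norm_sub _ _ _
    _ ≤ _ := add_le_add h1 h2
    _ = _ := by ring

/-! ### Translations and the inequality `2 Re ⟪V h, H₀ h⟫ ≥ -½ ‖h‖²` -/

/-- Translation `f ↦ f (· + y)` on `L²(ℝ)`. -/
noncomputable def translation (y : ℝ) : L2R →L[ℂ] L2R :=
  (Lp.compMeasurePreservingₗᵢ ℂ (fun x : ℝ => x + y)
    (measurePreserving_add_right volume y)).toContinuousLinearMap

theorem coeFn_translation (y : ℝ) (f : L2R) :
    translation y f =ᵐ[volume] fun x => f (x + y) :=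
  Lp.coeFn_compMeasurePreserving f (measurePreserving_add_right volume y)

/-- The character `exp (2 π i y ξ)`. -/
noncomputable def character (y : ℝ) : ℝ →ᵇ ℂ :=
  BoundedContinuousFunction.ofNormedAddCommGroup
    (fun ξ : ℝ => Complex.exp ((2 * Real.pi * y * ξ : ℝ) * Complex.I)) (by fun_prop) 1 fun ξ =>
      (Complex.norm_exp_ofReal_mul_I _).le

theorem character_apply (y ξ : ℝ) :
    character y ξ = Complex.exp ((2 * Real.pi * y * ξ : ℝ) * Complex.I) := rfl

theorem translation_gauss {β : ℝ} (hβ : 0 < β) (y : ℝ) (z : ℂ) :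
    translation y (gauss β z) =
      Complex.exp (-(β / 2) * y ^ 2 + z * y) • gauss β (z - β * y) := by
  refine Lp.ext ?_
  filter_upwards [coeFn_translation y (gauss β z), coeFn_gauss hβ (z - β * y),
    Lp.coeFn_smul (Complex.exp (-(β / 2) * y ^ 2 + z * y)) (gauss β (z - β * y)),
    (measurePreserving_add_right volume y).quasiMeasurePreserving.ae (coeFn_gauss hβ z)]
    with x h1 h2 h3 h4
  rw [h1, h3, Pi.smul_apply, h2, h4, smul_eq_mul, ← Complex.exp_add]
  congr 1
  push_cast
  ring

/-- Both sides are bounded operators applied to f, so the explicit transforms of Gaussians decide.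
-/
theorem fourier_translation (y : ℝ) (f : L2R) : Lp.fourierTransformₗᵢ ℝ ℂ (translation y f) =
    mulOp (character y) (Lp.fourierTransformₗᵢ ℝ ℂ f) := by
  let F : L2R →L[ℂ] L2R := ((Lp.fourierTransformₗᵢ ℝ ℂ : L2R ≃ₗᵢ[ℂ] L2R) : L2R →L[ℂ] L2R)
  suffices h : F ∘L translation y = mulOp (character y) ∘L F from
    congrArg (fun A : L2R →L[ℂ] L2R => A f) h
  refine eq_of_forall_gauss_eq one_pos fun η => ?_
  generalize (η * Complex.I : ℂ) = z
  change Lp.fourierTransformₗᵢ ℝ ℂ (translation y (gauss 1 z)) =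
    mulOp (character y) (Lp.fourierTransformₗᵢ ℝ ℂ (gauss 1 z))
  rw [translation_gauss one_pos, map_smul, fourier_gauss one_pos, fourier_gauss one_pos,
    map_smul, smul_smul]
  have h4 : 0 < 4 * Real.pi ^ 2 / 1 := by positivity
  have key : mulOp (character y)
      (gauss (4 * Real.pi ^ 2 / 1) (-(2 * Real.pi * Complex.I * z / (1 : ℝ)))) =
      gauss (4 * Real.pi ^ 2 / 1)
        (-(2 * Real.pi * Complex.I * (z - (1 : ℝ) * y) / (1 : ℝ))) := by
    refine Lp.ext ?_
    filter_upwards [coeFn_mulOp (character y) _, coeFn_gauss h4 _, coeFn_gauss h4 _]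
      with x h1 h2 h3
    rw [h1, h2, h3, character_apply, ← Complex.exp_add]
    congr 1
    push_cast
    ring
  rw [key, mul_left_comm, ← Complex.exp_add]
  congr 3
  push_cast
  ring

/-- `(2 f - f (· + y) - f (· - y)) / y²`. -/
noncomputable def secondDifference (y : ℝ) (f : L2R) : L2R :=
  ((y : ℂ) ^ 2)⁻¹ • ((2 : ℂ) • f - translation y f - translation (-y) f)

/-- In Fourier space this is multiplication by (2 sin(πξy)/y)², which is bounded by its limit 4π²ξ²
as y → 0; dominated convergence applies. -/
theorem tendsto_secondDifference {h u : L2R} (hu : (h, u) ∈ freeHamiltonian.graph) :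
    Tendsto (fun y => secondDifference y h) (𝓝[≠] 0) (𝓝 ((2 : ℂ) • u)) := by
  rw [mem_graph_freeHamiltonian_iff_fourier] at hu
  set m : ℝ → ℝ →ᵇ ℂ := fun y => ((y : ℂ) ^ 2)⁻¹ • ((2 : ℂ) • 1 - character y - character (-y))
    with hm
  have hop : ∀ y, Lp.fourierTransformₗᵢ ℝ ℂ (secondDifference y h) =
      mulOp (m y) (Lp.fourierTransformₗᵢ ℝ ℂ h) := by
    intro y
    simp only [secondDifference, hm, map_smul, map_sub, fourier_translation, mulOp_smul, mulOp_sub,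
      mulOp_one]
    rfl
  have hmx : ∀ y ξ, m y ξ = ((((2 * Real.sin (Real.pi * ξ * y)) / y) ^ 2 : ℝ) : ℂ) := by
    intro y ξ
    have h1 : m y ξ = ((y : ℂ) ^ 2)⁻¹ * (2 * 1 -
      Complex.exp ((2 * Real.pi * y * ξ : ℝ) * Complex.I) -
      Complex.exp ((2 * Real.pi * (-y) * ξ : ℝ) * Complex.I)) := rfl
    have h2 : (2 : ℝ) - 2 * Real.cos (2 * (Real.pi * ξ * y)) =
        4 * Real.sin (Real.pi * ξ * y) ^ 2 := by
      rw [Real.cos_two_mul, Real.cos_sq']; ring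
    have h3 : Complex.exp ((2 * Real.pi * y * ξ : ℝ) * Complex.I) +
        Complex.exp ((2 * Real.pi * (-y) * ξ : ℝ) * Complex.I) =
        ((2 * Real.cos (2 * (Real.pi * ξ * y)) : ℝ) : ℂ) := by
      push_cast
      rw [Complex.two_cos]
      congr 2 <;> ring
    rw [h1, mul_one, sub_sub, h3, div_pow, mul_pow, show (2 : ℝ) ^ 2 = 4 by norm_num, ← h2]
    push_cast
    ring
  have hlim : ∀ ξ : ℝ, Tendsto (fun y => m y ξ) (𝓝[≠] 0)
      (𝓝 (((2 * (2 * Real.pi ^ 2 * ξ ^ 2) : ℝ)) : ℂ)) := by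
    intro ξ
    simp only [hmx]
    refine (Complex.continuous_ofReal.tendsto _).comp ?_
    have hd : HasDerivAt (fun y : ℝ => 2 * Real.sin (Real.pi * ξ * y)) (2 * (Real.pi * ξ)) 0 := by
      have := (((hasDerivAt_id (0 : ℝ)).const_mul (Real.pi * ξ)).sin).const_mul 2
      refine this.congr_deriv ?_
      simp
    rw [hasDerivAt_iff_tendsto_slope] at hd
    have := hd.pow 2
    rw [show (2 * (Real.pi * ξ)) ^ 2 = 2 * (2 * Real.pi ^ 2 * ξ ^ 2) by ring] at this
    refine this.congr fun y => ?_
    simp only [slope_def_field, mul_zero, Real.sin_zero, sub_zero]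
  rw [(Lp.fourierTransformₗᵢ ℝ ℂ).isometry.isEmbedding.tendsto_nhds_iff]
  simp only [Function.comp_def, hop]
  have hu2 : Lp.fourierTransformₗᵢ ℝ ℂ ((2 : ℂ) • u) =ᵐ[volume] fun x =>
      ((2 * (2 * Real.pi ^ 2 * x ^ 2) : ℝ) : ℂ) * Lp.fourierTransformₗᵢ ℝ ℂ h x := by
    rw [map_smul]
    filter_upwards [hu, Lp.coeFn_smul (2 : ℂ) (Lp.fourierTransformₗᵢ ℝ ℂ u)] with x h1 h2
    rw [h2, Pi.smul_apply, h1, smul_eq_mul, kineticSymbol_apply]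
    push_cast
    ring
  refine tendsto_mulOp_of_dominated (C := 1) ?_ ?_
  · filter_upwards [self_mem_nhdsWithin] with y hy
    have hy2 : 0 < y ^ 2 := by
      have : y ≠ 0 := hy
      positivity
    filter_upwards [hu2] with ξ hξ
    have h4 : ‖m y ξ‖ ≤ 2 * (2 * Real.pi ^ 2 * ξ ^ 2) := by
      rw [hmx, Complex.norm_real, Real.norm_of_nonneg (by positivity), div_pow,
        div_le_iff₀ hy2]
      have := sq_le_sq.2 (Real.abs_sin_le_abs (x := Real.pi * ξ * y))
      nlinarith
    rw [hξ, norm_mul, norm_mul, Complex.norm_real, Real.norm_of_nonneg (by positivity)]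
    nlinarith [norm_nonneg (Lp.fourierTransformₗᵢ ℝ ℂ h ξ)]
  · filter_upwards [hu2] with ξ hξ
    rw [hξ]
    exact (hlim ξ).mul_const _

theorem two_mul_re_conj_mul_le (a b : ℂ) :
    2 * (b * starRingEnd ℂ a).re ≤ ‖a‖ ^ 2 + ‖b‖ ^ 2 := by
  have h := Complex.re_le_norm (b * starRingEnd ℂ a)
  rw [norm_mul, Complex.norm_conj] at h
  nlinarith [sq_nonneg (‖a‖ - ‖b‖)]

/-- Pointwise, 2 Re(h(x±y) h̄(x)) ≤ |h(x)|² + |h(x±y)|². After integration against x²/2 and a shift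
of variables, (x-y)² + (x+y)² = 2x² + 2y²: the first moments cancel and only -(y²/2)‖h‖² is left.
Finite differences avoid any integration by parts. -/
theorem neg_le_re_inner_secondDifference {h v : L2R} (hv : (h, v) ∈ potential.graph) {y : ℝ}
    (hy : y ≠ 0) : -(1 / 2) * ‖h‖ ^ 2 ≤ (inner ℂ v (secondDifference y h)).re := by
  rw [mem_graph_potential_iff] at hv
  set a : ℝ → ℝ := fun x => ‖h x‖ ^ 2 with ha
  have ia : Integrable a := (Lp.memLp h).norm.integrable_sq
  have ia2 : Integrable fun x => x ^ 2 * a x := by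
    refine (((Lp.memLp v).norm.integrable_mul (Lp.memLp h).norm).const_mul 2).congr ?_
    filter_upwards [hv] with x hx
    rw [Pi.mul_apply, hx, norm_mul, potentialSymbol_apply, Complex.norm_real,
      Real.norm_of_nonneg (by positivity)]
    simp only [ha]
    ring
  have ia1 : Integrable fun x => x * a x := by
    refine (ia.add ia2).mono' (by
      exact continuous_id.aestronglyMeasurable.mul ia.aestronglyMeasurable) (.of_forall fun x => ?_)
    have : 0 ≤ a x := sq_nonneg _
    rw [norm_mul, Real.norm_of_nonneg this, Real.norm_eq_abs, Pi.add_apply]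
    nlinarith [sq_nonneg (|x| - 1), sq_abs x]
  have iq : ∀ c : ℝ, Integrable (fun x => (x - c) ^ 2 * a x) ∧ ∫ x, (x - c) ^ 2 * a x =
      (∫ x, x ^ 2 * a x) - 2 * c * (∫ x, x * a x) + c ^ 2 * ∫ x, a x := by
    intro c
    have e : (fun x => (x - c) ^ 2 * a x) =
        fun x => x ^ 2 * a x - 2 * c * (x * a x) + c ^ 2 * a x := by
      funext x; ring
    have i1 := ia1.const_mul (2 * c)
    have i0 := ia.const_mul (c ^ 2)
    have i2 : Integrable fun x => x ^ 2 * a x - 2 * c * (x * a x) := ia2.sub i1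
    refine ⟨by rw [e]; exact i2.add i0, ?_⟩
    rw [e, integral_add i2 i0, integral_sub ia2 i1, integral_const_mul,
      integral_const_mul]
  have is : ∀ c : ℝ, Integrable (fun x => x ^ 2 * a (x + c)) ∧
      ∫ x, x ^ 2 * a (x + c) = ∫ x, (x - c) ^ 2 * a x := by
    intro c
    have e : (fun x => x ^ 2 * a (x + c)) = fun x => (fun x => (x - c) ^ 2 * a x) (x + c) := by
      funext x; simp
    constructor
    · rw [e]; exact (iq c).1.comp_add_right c
    · rw [e]; exact integral_add_right_eq_self (fun x => (x - c) ^ 2 * a x) c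
  set d : L2R := (2 : ℂ) • h - translation y h - translation (-y) h with hd
  have hdx : d =ᵐ[volume] fun x => 2 * h x - h (x + y) - h (x + -y) := by
    filter_upwards [Lp.coeFn_sub ((2 : ℂ) • h - translation y h) (translation (-y) h),
      Lp.coeFn_sub ((2 : ℂ) • h) (translation y h), Lp.coeFn_smul (2 : ℂ) h,
      coeFn_translation y h, coeFn_translation (-y) h] with x h1 h2 h3 h4 h5
    rw [hd, h1, Pi.sub_apply, h2, Pi.sub_apply, h3, h4, h5, Pi.smul_apply, smul_eq_mul]
  have hinner : -(y ^ 2 / 2) * ‖h‖ ^ 2 ≤ (inner ℂ v d).re := by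
    have e1 : (inner ℂ v d).re = ∫ x, (inner ℂ (v x) (d x)).re := by
      rw [L2.inner_def]
      exact (integral_re (L2.integrable_inner (𝕜 := ℂ) v d)).symm
    have i0 := ia2.const_mul (1 / 2)
    have i1 := (is y).1.const_mul (1 / 4)
    have i2 := (is (-y)).1.const_mul (1 / 4)
    have i3 : Integrable fun x => 1 / 2 * (x ^ 2 * a x) - 1 / 4 * (x ^ 2 * a (x + y)) := i0.sub i1
    have e2 : -(y ^ 2 / 2) * ‖h‖ ^ 2 =
        ∫ x, (1 / 2 * (x ^ 2 * a x) - 1 / 4 * (x ^ 2 * a (x + y)) -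
          1 / 4 * (x ^ 2 * a (x + -y))) := by
      rw [integral_sub i3 i2, integral_sub i0 i1, integral_const_mul,
        integral_const_mul, integral_const_mul, (is y).2, (is (-y)).2, (iq y).2, (iq (-y)).2,
        norm_sq_eq_integral]
      ring
    rw [e1, e2]
    refine integral_mono_ae (i3.sub i2) (L2.integrable_inner (𝕜 := ℂ) v d).re ?_
    filter_upwards [hv, hdx] with x h1 h2
    have p1 := two_mul_re_conj_mul_le (h x) (h (x + y))
    have p2 := two_mul_re_conj_mul_le (h x) (h (x + -y))
    have p3 : (h x * starRingEnd ℂ (h x)).re = ‖h x‖ ^ 2 := by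
      rw [Complex.mul_conj, Complex.ofReal_re, Complex.normSq_eq_norm_sq]
    have e3 : (inner ℂ (v x) (d x)).re = x ^ 2 / 2 * (2 * (h x * starRingEnd ℂ (h x)).re -
        (h (x + y) * starRingEnd ℂ (h x)).re - (h (x + -y) * starRingEnd ℂ (h x)).re) := by
      rw [h1, h2, RCLike.inner_apply, map_mul, Complex.conj_ofReal, potentialSymbol_apply,
        mul_left_comm, Complex.re_ofReal_mul]
      congr 1
      rw [sub_mul, sub_mul, mul_assoc, Complex.sub_re, Complex.sub_re]
      simp
    rw [e3, p3]
    simp only [ha]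
    nlinarith [sq_nonneg x]
  have hy2 : 0 < y ^ 2 := by positivity
  have e : (inner ℂ v (secondDifference y h)).re = (y ^ 2)⁻¹ * (inner ℂ v d).re := by
    rw [secondDifference, inner_smul_right, ← Complex.ofReal_pow, ← Complex.ofReal_inv,
      Complex.re_ofReal_mul]
  rw [e, inv_mul_eq_div, le_div_iff₀ hy2]
  linarith

/-- Expand ‖u+v‖² and bound the cross term 2 Re⟪v, u⟫ below by -½‖h‖², the limit of the second
difference inequality. This separates the two parts of H on its domain. -/
theorem norm_sq_potential_le {h u v : L2R} (hu : (h, u) ∈ freeHamiltonian.graph)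
    (hv : (h, v) ∈ potential.graph) : ‖v‖ ^ 2 ≤ ‖u + v‖ ^ 2 + 1 / 2 * ‖h‖ ^ 2 := by
  have h1 : -(1 / 2) * ‖h‖ ^ 2 ≤ (inner ℂ v ((2 : ℂ) • u)).re := by
    have ht : Tendsto (fun y => (inner ℂ v (secondDifference y h)).re) (𝓝[≠] 0)
        (𝓝 (inner ℂ v ((2 : ℂ) • u)).re) :=
      (Complex.continuous_re.tendsto _).comp
        (tendsto_const_nhds.inner (tendsto_secondDifference hu))
    refine ge_of_tendsto ht ?_
    filter_upwards [self_mem_nhdsWithin] with y hy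
    exact neg_le_re_inner_secondDifference hv hy
  have h2 : (inner ℂ v ((2 : ℂ) • u)).re = 2 * (inner ℂ v u).re := by
    rw [inner_smul_right]
    simp
  have h3 := norm_add_sq (𝕜 := ℂ) v u
  rw [add_comm v u] at h3
  have h4 : RCLike.re (inner ℂ v u) = (inner ℂ v u).re := rfl
  rw [h4] at h3
  nlinarith [sq_nonneg ‖u‖]

/-! ### The generator of the oscillator semigroup -/

theorem tendsto_apply_of_norm_le_one {ι : Type*} {l : Filter ι} {A : ℝ → L2R →L[ℂ] L2R}
    (hA : ∀ t, ‖A t‖ ≤ 1) (hc : ∀ f, Continuous fun t => A t f) {τ : ι → ℝ} {τ₀ : ℝ}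
    {g : ι → L2R} {g₀ : L2R} (hτ : Tendsto τ l (𝓝 τ₀)) (hg : Tendsto g l (𝓝 g₀)) :
    Tendsto (fun i => A (τ i) (g i)) l (𝓝 (A τ₀ g₀)) := by
  have h1 : Tendsto (fun i => A (τ i) (g i - g₀)) l (𝓝 0) := by
    refine squeeze_zero_norm (fun i => ?_) (tendsto_iff_norm_sub_tendsto_zero.1 hg)
    simpa using (A (τ i)).le_of_opNorm_le (hA _) (g i - g₀)
  have h2 := h1.add (((hc g₀).tendsto τ₀).comp hτ)
  simpa using h2

theorem continuous_tanh_half : Continuous fun t : ℝ => Real.sinh (t / 2) / Real.cosh (t / 2) :=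
  (by fun_prop : Continuous fun t : ℝ => Real.sinh (t / 2)).div (by fun_prop)
    fun t => (Real.cosh_pos _).ne'

theorem continuous_oscSemigroup (f : L2R) : Continuous fun t : ℝ => oscSemigroup 1 t f := by
  simp only [oscSemigroup, one_mul, div_one, mul_apply_eq_comp]
  refine continuous_iff_continuousAt.2 fun t => ?_
  have h1 := continuous_tanh_half.tendsto t
  refine tendsto_apply_of_norm_le_one (norm_expMul_le potentialSymbol)
    (continuous_expMul potentialSymbol) h1 ?_
  refine tendsto_apply_of_norm_le_one norm_heat_le continuous_heat
    (Real.continuous_sinh.tendsto t) ?_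
  exact ((continuous_expMul potentialSymbol f).tendsto _).comp h1

/-- The chain rule at 0: the factor τ(t)/t tends to κ. -/
theorem tendsto_smul_sub_comp {A : ℝ → L2R →L[ℂ] L2R} {f g : L2R}
    (h : Tendsto (fun t : ℝ≥0 => ((t : ℝ) : ℂ)⁻¹ • (f - A t f)) (𝓝[≠] 0) (𝓝 g))
    {τ : ℝ → ℝ} {κ : ℝ} (hτ : HasDerivAt τ κ 0) (hτ0 : τ 0 = 0) (hpos : ∀ t, 0 < t → 0 < τ t) :
    Tendsto (fun t : ℝ≥0 => ((t : ℝ) : ℂ)⁻¹ • (f - A (τ t) f)) (𝓝[≠] 0) (𝓝 ((κ : ℂ) • g)) := by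
  have hc : Tendsto (fun t : ℝ≥0 => (t : ℝ)) (𝓝[≠] 0) (𝓝[≠] 0) := by
    refine tendsto_nhdsWithin_iff.2 ⟨?_, ?_⟩
    · exact (NNReal.continuous_coe.tendsto' 0 0 rfl).mono_left nhdsWithin_le_nhds
    · filter_upwards [self_mem_nhdsWithin] with t ht
      simpa using ht
  have hpos' : ∀ᶠ t : ℝ≥0 in 𝓝[≠] 0, 0 < τ t := by
    filter_upwards [self_mem_nhdsWithin] with t ht
    refine hpos t ?_
    have : (0 : ℝ≥0) < t := pos_iff_ne_zero.2 ht
    exact_mod_cast this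
  have h1 : Tendsto (fun t : ℝ≥0 => Real.toNNReal (τ t)) (𝓝[≠] 0) (𝓝[≠] 0) := by
    refine tendsto_nhdsWithin_iff.2 ⟨?_, ?_⟩
    · have : Tendsto (fun t : ℝ≥0 => τ t) (𝓝[≠] 0) (𝓝 0) := by
        have := hτ.continuousAt.tendsto.comp (hc.mono_right nhdsWithin_le_nhds)
        rwa [hτ0] at this
      have h3 := (continuous_real_toNNReal.tendsto 0).comp this
      rwa [Real.toNNReal_zero] at h3
    · filter_upwards [hpos'] with t ht
      simpa using ht
  have h2 : Tendsto (fun t : ℝ≥0 => ((τ t / t : ℝ) : ℂ)) (𝓝[≠] 0) (𝓝 (κ : ℂ)) := by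
    refine (Complex.continuous_ofReal.tendsto _).comp ?_
    have := (hasDerivAt_iff_tendsto_slope.1 hτ).comp hc
    refine this.congr fun t => ?_
    rw [Function.comp_apply, slope_def_field, hτ0, sub_zero, sub_zero]
  refine (h2.smul (h.comp h1)).congr' ?_
  filter_upwards [hpos'] with t ht
  have : ((τ t : ℝ) : ℂ) ≠ 0 := by exact_mod_cast ht.ne'
  rw [Function.comp_apply, Real.coe_toNNReal _ ht.le, smul_smul]
  congr 1
  push_cast
  field_simp

theorem tendsto_oscSemigroup {f u v : L2R} (hu : (f, u) ∈ freeHamiltonian.graph)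
    (hv : (f, v) ∈ potential.graph) :
    Tendsto (fun t : ℝ≥0 => ((t : ℝ) : ℂ)⁻¹ • (f - oscSemigroup 1 t f)) (𝓝[≠] 0)
      (𝓝 (u + v)) := by
  set a : ℝ → ℝ := fun t => Real.sinh (t / 2) / Real.cosh (t / 2) with ha
  have hda : HasDerivAt a (1 / 2) 0 := by
    have h2 := (hasDerivAt_id (0 : ℝ)).div_const 2
    refine (h2.sinh.div h2.cosh (Real.cosh_pos _).ne').congr_deriv ?_
    simp
  have hdb : HasDerivAt Real.sinh 1 0 := by simpa using Real.hasDerivAt_sinh 0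
  have hapos : ∀ t, 0 < t → 0 < a t := fun t ht =>
    div_pos (Real.sinh_pos_iff.2 (by linarith)) (Real.cosh_pos _)
  have hV := tendsto_smul_sub_comp (A := expV) ((tendsto_expMul_iff _ _ _).2
    ((mem_graph_potential_iff f v).1 hv)) hda (by simp [ha]) hapos
  have hH := tendsto_smul_sub_comp (A := heat) ((tendsto_heat_iff f u).2 hu) hdb (by simp)
    fun t ht => Real.sinh_pos_iff.2 ht
  have hcoe : Tendsto (fun t : ℝ≥0 => (t : ℝ)) (𝓝[≠] 0) (𝓝 0) :=
    (NNReal.continuous_coe.tendsto' 0 0 rfl).mono_left nhdsWithin_le_nhds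
  have hta : Tendsto (fun t : ℝ≥0 => a t) (𝓝[≠] 0) (𝓝 (a 0)) :=
    (continuous_tanh_half.tendsto 0).comp hcoe
  have htb : Tendsto (fun t : ℝ≥0 => Real.sinh t) (𝓝[≠] 0) (𝓝 (Real.sinh 0)) :=
    (Real.continuous_sinh.tendsto 0).comp hcoe
  have hE := fun {g : ℝ≥0 → L2R} {g₀ : L2R} => tendsto_apply_of_norm_le_one (g := g) (g₀ := g₀)
    (norm_expMul_le potentialSymbol) (continuous_expMul potentialSymbol) hta
  have h3 := hE (tendsto_apply_of_norm_le_one norm_heat_le continuous_heat htb hV)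
  -- This is f - ABAf = (f - Af) + A(f - Bf) + AB(f - Af), divided by t. The rates tanh(t/2) ~ t/2
  -- and sinh t ~ t give ½v + u + ½v.
  have h4 := (hV.add (hE hH)).add h3
  have ha0 : a 0 = 0 := by simp [ha]
  rw [ha0, Real.sinh_zero, expMul_zero, heat_zero] at h4
  have e : ((1 / 2 : ℝ) : ℂ) • v + (1 : L2R →L[ℂ] L2R) (((1 : ℝ) : ℂ) • u) +
      (1 : L2R →L[ℂ] L2R) ((1 : L2R →L[ℂ] L2R) (((1 / 2 : ℝ) : ℂ) • v)) = u + v := by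
    simp only [one_apply_eq_self, Complex.ofReal_one, one_smul]
    push_cast
    module
  rw [e] at h4
  refine h4.congr fun t => ?_
  simp only [oscSemigroup, one_mul, div_one, mul_apply_eq_comp, map_smul, map_sub, ← smul_add,
    expV]
  congr 1
  change f - expMul potentialSymbol (a t) f + _ + _ = f - expMul potentialSymbol (a t) _
  abel

/-- The oscillator semigroup maps `L²(ℝ)` into `D(H₀) ∩ D(V)`. -/
theorem exists_mem_graph_oscSemigroup {t : ℝ} (ht : 0 < t) (f : L2R) :
    ∃ u v, (oscSemigroup 1 t f, u) ∈ freeHamiltonian.graph ∧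
      (oscSemigroup 1 t f, v) ∈ potential.graph := by
  have ha : 0 < Real.sinh (t / 2) / Real.cosh (t / 2) :=
    div_pos (Real.sinh_pos_iff.2 (by linarith)) (Real.cosh_pos _)
  obtain ⟨u, hu⟩ := exists_mem_graph_heat ha
    (expV (Real.sinh t) (heat (Real.sinh (t / 2) / Real.cosh (t / 2)) f))
  obtain ⟨v, hv⟩ := exists_coeFn_eq_mul_expMul potentialSymbol ha
    (heat (Real.sinh t) (expV (Real.sinh (t / 2) / Real.cosh (t / 2)) f))
  refine ⟨u, v, ?_, ?_⟩
  · rwa [oscSemigroup_one_eq_heat_mul ht.le]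
  · rw [mem_graph_potential_iff, oscSemigroup, one_mul, div_one]
    exact hv

theorem mem_graph_of_tendsto_oscSemigroup {f g : L2R}
    (h : Tendsto (fun t : ℝ≥0 => ((t : ℝ) : ℂ)⁻¹ • (f - oscSemigroup 1 t f)) (𝓝[≠] 0) (𝓝 g)) :
    (f, g) ∈ harmonicOscillator.graph := by
  set ε : ℕ → ℝ := fun n => 1 / ((n : ℝ) + 1) with hε
  have hε0 : ∀ n, 0 < ε n := fun n => by simp only [hε]; positivity
  have hεt : Tendsto ε atTop (𝓝 0) := tendsto_one_div_add_atTop_nhds_zero_nat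
  have hS : ∀ k : L2R, Tendsto (fun n => oscSemigroup 1 (ε n) k) atTop (𝓝 k) := fun k => by
    have := ((continuous_oscSemigroup k).tendsto 0).comp hεt
    rwa [oscSemigroup_zero, one_apply_eq_self] at this
  choose u v hu hv using fun n => exists_mem_graph_oscSemigroup (hε0 n) f
  have hcomm : ∀ n, u n + v n = oscSemigroup 1 (ε n) g := by
    intro n
    have h1 := tendsto_oscSemigroup (hu n) (hv n)
    have h2 := ((oscSemigroup 1 (ε n)).continuous.tendsto g).comp h
    refine tendsto_nhds_unique h1 (h2.congr fun t => ?_)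
    have h3 : oscSemigroup 1 (ε n) (oscSemigroup 1 t f) =
        oscSemigroup 1 t (oscSemigroup 1 (ε n) f) := by
      rw [← mul_apply_eq_comp, ← mul_apply_eq_comp, 
        ← oscSemigroup_add one_pos (hε0 n).le t.coe_nonneg,
        ← oscSemigroup_add one_pos t.coe_nonneg (hε0 n).le, add_comm]
    rw [Function.comp_apply, map_smul, map_sub, h3]
  have hcauchy : CauchySeq v := by
    have hc1 := (hS g).cauchySeq
    have hc2 := (hS f).cauchySeq
    rw [Metric.cauchySeq_iff] at hc1 hc2 ⊢
    intro δ hδ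
    obtain ⟨N1, h1⟩ := hc1 (δ / 2) (by linarith)
    obtain ⟨N2, h2⟩ := hc2 (δ / 2) (by linarith)
    refine ⟨max N1 N2, fun m hm n hn => ?_⟩
    have k1 := h1 m ((le_max_left _ _).trans hm) n ((le_max_left _ _).trans hn)
    have k2 := h2 m ((le_max_right _ _).trans hm) n ((le_max_right _ _).trans hn)
    rw [dist_eq_norm] at k1 k2 ⊢
    have k3 := norm_sq_potential_le (u := u m - u n) (v := v m - v n)
      (freeHamiltonian.graph.sub_mem (hu m) (hu n)) (potential.graph.sub_mem (hv m) (hv n))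
    rw [show u m - u n + (v m - v n) = (u m + v m) - (u n + v n) by abel, hcomm, hcomm] at k3
    nlinarith [norm_nonneg (v m - v n), norm_nonneg (oscSemigroup 1 (ε m) g - oscSemigroup 1 (ε n) g),
      norm_nonneg (oscSemigroup 1 (ε m) f - oscSemigroup 1 (ε n) f)]
  obtain ⟨w, hw⟩ := cauchySeq_tendsto_of_complete hcauchy
  have hu' : Tendsto u atTop (𝓝 (g - w)) := by
    refine ((hS g).sub hw).congr fun n => ?_
    rw [← hcomm]
    abel
  rw [mem_graph_harmonicOscillator_iff]
  refine ⟨g - w, w, ?_, ?_, by abel⟩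
  · exact isClosed_graph_freeHamiltonian.mem_of_tendsto ((hS f).prodMk_nhds hu') (.of_forall hu)
  · exact isClosed_graph_potential.mem_of_tendsto ((hS f).prodMk_nhds hw) (.of_forall hv)

theorem isExpNeg_harmonicOscillator :
    IsExpNeg harmonicOscillator fun t : ℝ≥0 => oscSemigroup 1 t where
  map_zero := oscSemigroup_zero 1
  map_add s t := oscSemigroup_add one_pos s.2 t.2
  strongly_continuous f := (continuous_oscSemigroup f).comp NNReal.continuous_coe
  generator f g := by
    refine ⟨fun h => ?_, mem_graph_of_tendsto_oscSemigroup⟩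
    obtain ⟨u, v, hu, hv, rfl⟩ := (mem_graph_harmonicOscillator_iff f g).1 h
    exact tendsto_oscSemigroup hu hv

/-! ### Identification of the exponentials -/

theorem isExpNeg_expNeg {E : Type*} [NormedAddCommGroup E] [NormedSpace ℂ E]
    {A : E →ₗ.[ℂ] E} {S : ℝ≥0 → E →L[ℂ] E} (h : IsExpNeg A S) : IsExpNeg A (expNeg A) := by
  have hex : ∃ S : ℝ≥0 → E →L[ℂ] E, IsExpNeg A S := ⟨S, h⟩
  rw [expNeg, dif_pos hex]
  exact hex.choose_spec

/-- If the semigroup is smoothing, then it is the exponential of its generator. -/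
theorem expNeg_eq_of_smoothing {E : Type*} [NormedAddCommGroup E] [NormedSpace ℂ E]
    [CompleteSpace E] {A : E →ₗ.[ℂ] E} {S : ℝ≥0 → E →L[ℂ] E} (h : IsExpNeg A S)
    (hs : ∀ t : ℝ≥0, 0 < t → ∀ f, ∃ g, (S t f, g) ∈ A.graph) : expNeg A = S := by
  refine IsExpNeg.unique (fun f => ?_) (isExpNeg_expNeg h) h
  have h1 : Tendsto (fun t : ℝ≥0 => S t f) (𝓝[≠] 0) (𝓝 f) := by
    have := (h.strongly_continuous f).tendsto 0
    rw [h.map_zero] at this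
    exact this.mono_left nhdsWithin_le_nhds
  refine mem_closure_of_tendsto h1 ?_
  filter_upwards [self_mem_nhdsWithin] with t ht
  obtain ⟨g, hg⟩ := hs t (pos_iff_ne_zero.2 ht) f
  exact LinearPMap.mem_domain_of_mem_graph hg

theorem expNeg_potential : expNeg potential = fun t : ℝ≥0 => expV t :=
  expNeg_eq_of_smoothing isExpNeg_potential fun t ht f => by
    obtain ⟨g, hg⟩ := exists_coeFn_eq_mul_expMul potentialSymbol (NNReal.coe_pos.2 ht) f
    exact ⟨g, (mem_graph_potential_iff _ _).2 hg⟩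

theorem expNeg_freeHamiltonian : expNeg freeHamiltonian = fun t : ℝ≥0 => heat t :=
  expNeg_eq_of_smoothing isExpNeg_freeHamiltonian fun _ ht f =>
    exists_mem_graph_heat (NNReal.coe_pos.2 ht) f

theorem expNeg_harmonicOscillator :
    expNeg harmonicOscillator = fun t : ℝ≥0 => oscSemigroup 1 t :=
  expNeg_eq_of_smoothing isExpNeg_harmonicOscillator fun t ht f => by
    obtain ⟨u, v, hu, hv⟩ := exists_mem_graph_oscSemigroup (NNReal.coe_pos.2 ht) f
    exact ⟨u + v, (mem_graph_harmonicOscillator_iff _ _).2 ⟨u, v, hu, hv, rfl⟩⟩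

/-! ### Elementary inequalities for `arsinh` -/

theorem arsinh_le_self {u : ℝ} (hu : 0 ≤ u) : Real.arsinh u ≤ u := by
  have := Real.self_le_sinh_iff.2 (Real.arsinh_nonneg_iff.2 hu)
  rwa [Real.sinh_arsinh] at this

theorem div_sqrt_le_arsinh {u : ℝ} (hu : 0 ≤ u) : u / √(1 + u ^ 2) ≤ Real.arsinh u := by
  have hmono : MonotoneOn (fun v => v * Real.cosh v - Real.sinh v) (Set.Ici 0) := by
    refine monotoneOn_of_deriv_nonneg (convex_Ici 0) (by fun_prop) (by fun_prop) fun v hv => ?_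
    rw [interior_Ici] at hv
    have hd : HasDerivAt (fun v => v * Real.cosh v - Real.sinh v) (v * Real.sinh v) v := by
      refine (((hasDerivAt_id v).mul (Real.hasDerivAt_cosh v)).sub
        (Real.hasDerivAt_sinh v)).congr_deriv ?_
      simp
    rw [hd.deriv]
    exact mul_nonneg (le_of_lt hv) (Real.sinh_nonneg_iff.2 (le_of_lt hv))
  have hv := Real.arsinh_nonneg_iff.2 hu
  have := hmono (Set.mem_Ici.2 le_rfl) (Set.mem_Ici.2 hv) hv
  simp only [Real.sinh_arsinh, Real.cosh_arsinh, zero_mul, Real.sinh_zero, sub_zero] at this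
  rw [div_le_iff₀ (Real.sqrt_pos.2 (by positivity))]
  linarith

theorem sqrt_one_add_sq_le (u : ℝ) : √(1 + u ^ 2) ≤ 1 + u ^ 2 / 2 := by
  rw [Real.sqrt_le_left (by positivity)]
  nlinarith [sq_nonneg (u ^ 2)]

theorem add_cube_div_six_le_sinh {v : ℝ} (hv : 0 ≤ v) : v + v ^ 3 / 6 ≤ Real.sinh v := by
  have hmono : MonotoneOn (fun v => Real.sinh v - (v + v ^ 3 / 6)) (Set.Ici 0) := by
    refine monotoneOn_of_deriv_nonneg (convex_Ici 0) (by fun_prop) (by fun_prop) fun v hv => ?_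
    rw [interior_Ici] at hv
    have hd : HasDerivAt (fun v => Real.sinh v - (v + v ^ 3 / 6))
        (Real.cosh v - (1 + v ^ 2 / 2)) v := by
      refine ((Real.hasDerivAt_sinh v).sub ((hasDerivAt_id v).add
        (((hasDerivAt_id v).pow 3).div_const 6))).congr_deriv ?_
      simp
      ring
    rw [hd.deriv]
    have h1 := Real.cosh_two_mul (v / 2)
    rw [mul_div_cancel₀ v two_ne_zero] at h1
    have h2 := Real.self_le_sinh_iff.2 (show 0 ≤ v / 2 by have : 0 < v := hv; linarith)
    have h3 := Real.cosh_sq (v / 2)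
    have : 0 < v := hv
    nlinarith
  have := hmono (Set.mem_Ici.2 le_rfl) (Set.mem_Ici.2 hv) hv
  simp only [Real.sinh_zero, zero_add] at this
  norm_num at this
  linarith

/-! ### The error of the product formula -/

/-- The symmetric product formula for the harmonic oscillator is an oscillator semigroup with
shifted frequency and time. -/
theorem product_pow_eq_oscSemigroup {u : ℝ} (hu : 0 ≤ u) (n : ℕ) :
    (expV u * heat (2 * u) * expV u) ^ n =
      oscSemigroup (√(1 + u ^ 2)) (n * (2 * Real.arsinh u)) := by
  have := Real.arsinh_nonneg_iff.2 hu
  rw [expV_mul_heat_mul_expV_eq, oscSemigroup_nat_mul (Real.sqrt_pos.2 (by positivity))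
    (by positivity)]

theorem le_norm_product_sub {n : ℕ} (hn : 1 ≤ n) {t : ℝ} (ht : 0 ≤ t) :
    Real.exp (-t / 2) * (t ^ 3 / (48 * (1 + t) ^ 3)) * ((n : ℝ) ^ 2)⁻¹ ≤
      ‖(expV (t / (2 * n)) * heat (2 * (t / (2 * n))) * expV (t / (2 * n))) ^ n -
        oscSemigroup 1 t‖ := by
  have hn1 : (1 : ℝ) ≤ n := by exact_mod_cast hn
  have hn0 : (0 : ℝ) < n := by linarith
  set u := t / (2 * n) with hu
  have hu0 : 0 ≤ u := by positivity
  have htu : t = 2 * n * u := by rw [hu]; field_simp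
  have hut : u ≤ t := by nlinarith
  set v := Real.arsinh u with hv
  have hv0 : 0 ≤ v := Real.arsinh_nonneg_iff.2 hu0
  rw [product_pow_eq_oscSemigroup hu0]
  have hsq : 0 < √(1 + u ^ 2) := Real.sqrt_pos.2 (by positivity)
  have h1 := le_norm_oscSemigroup hsq (s := n * (2 * v)) (by positivity)
  have h2 := norm_oscSemigroup_le one_pos ht
  have h3 := norm_sub_norm_le (oscSemigroup (√(1 + u ^ 2)) (n * (2 * v))) (oscSemigroup 1 t)
  have h4 : Real.exp (-t / 2) * ((t - n * (2 * v)) / 2) ≤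
      Real.exp (-(n * (2 * v)) / 2) - Real.exp (-t / 2) := by
    have e : Real.exp (-(n * (2 * v)) / 2) =
        Real.exp (-t / 2) * Real.exp ((t - n * (2 * v)) / 2) := by
      rw [← Real.exp_add]; ring_nf
    have := Real.add_one_le_exp ((t - n * (2 * v)) / 2)
    rw [e]
    nlinarith [Real.exp_pos (-t / 2)]
  have h5 : v + v ^ 3 / 6 ≤ u := by
    have := add_cube_div_six_le_sinh hv0
    rwa [hv, Real.sinh_arsinh] at this
  have h6 : u / (1 + t) ≤ v := by
    refine le_trans ?_ (div_sqrt_le_arsinh hu0)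
    gcongr
    rw [Real.sqrt_le_left (by linarith)]
    nlinarith
  have h7 : t ^ 3 / (48 * (1 + t) ^ 3) * ((n : ℝ) ^ 2)⁻¹ ≤ (t - n * (2 * v)) / 2 := by
    calc t ^ 3 / (48 * (1 + t) ^ 3) * ((n : ℝ) ^ 2)⁻¹ = n * ((u / (1 + t)) ^ 3 / 6) := by
          rw [hu]
          field_simp
          ring
      _ ≤ n * (v ^ 3 / 6) := by gcongr
      _ ≤ n * (u - v) := by gcongr; linarith
      _ = (t - n * (2 * v)) / 2 := by rw [htu]; ring
  calc _ = Real.exp (-t / 2) * (t ^ 3 / (48 * (1 + t) ^ 3) * ((n : ℝ) ^ 2)⁻¹) := by ring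
    _ ≤ Real.exp (-t / 2) * ((t - n * (2 * v)) / 2) := by gcongr
    _ ≤ _ := by linarith

theorem sq_mul_exp_neg_le {n : ℕ} (hn : 4 ≤ n) {t : ℝ} (ht : 0 ≤ t) :
    t ^ 2 * Real.exp (-(n * (2 * Real.arsinh (t / (2 * n)))) / 4) ≤ 64 := by
  have hn4 : (4 : ℝ) ≤ n := by exact_mod_cast hn
  set u := t / (2 * n) with hu
  have hu0 : 0 ≤ u := by positivity
  have h1 : 1 + u ≤ Real.exp (Real.arsinh u) := by
    have : 1 ≤ √(1 + u ^ 2) := Real.one_le_sqrt.2 (by nlinarith)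
    rw [Real.exp_arsinh]
    linarith
  have h2 : 1 + t / 8 ≤ Real.exp (n / 4 * Real.arsinh u) := by
    calc 1 + t / 8 = 1 + n / 4 * u := by rw [hu]; field_simp; ring
      _ ≤ (1 + u) ^ ((n : ℝ) / 4) :=
        one_add_mul_self_le_rpow_one_add (by linarith) (by linarith)
      _ ≤ Real.exp (Real.arsinh u) ^ ((n : ℝ) / 4) := by gcongr
      _ = _ := by rw [← Real.exp_mul, mul_comm]
  have e : Real.exp (-(n * (2 * Real.arsinh u)) / 4) =
      (Real.exp (n / 4 * Real.arsinh u) ^ 2)⁻¹ := by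
    rw [← Real.exp_nat_mul, ← Real.exp_neg]
    push_cast
    ring_nf
  rw [e, ← div_eq_mul_inv, div_le_iff₀ (by positivity)]
  nlinarith

theorem norm_product_sub_le {n : ℕ} (hn : 1 ≤ n) {t : ℝ} (ht : 0 ≤ t) :
    ‖(expV (t / (2 * n)) * heat (2 * (t / (2 * n))) * expV (t / (2 * n))) ^ n -
        oscSemigroup 1 t‖ ≤ 64 * min t 1 * ((n : ℝ) ^ 2)⁻¹ := by
  have hn1 : (1 : ℝ) ≤ n := by exact_mod_cast hn
  have hn0 : (0 : ℝ) < n := by linarith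
  have hu0 : 0 ≤ t / (2 * n) := by positivity
  rw [product_pow_eq_oscSemigroup hu0]
  rcases ht.eq_or_lt with rfl | htpos
  · simp [oscSemigroup_zero]
  have hexp := fun h : 4 ≤ n => sq_mul_exp_neg_le h ht
  set u := t / (2 * n) with hu
  have hupos : 0 < u := by positivity
  have htu : t = 2 * n * u := by rw [hu]; field_simp
  set v := Real.arsinh u with hv
  have hv0 : 0 < v := Real.arsinh_pos_iff.2 hupos
  set ω := √(1 + u ^ 2) with hω
  have hω1 : 1 ≤ ω := Real.one_le_sqrt.2 (by nlinarith)
  have hω2 : ω ≤ 1 + u ^ 2 / 2 := sqrt_one_add_sq_le u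
  have hvu : v ≤ u := arsinh_le_self hu0
  have hst : n * (2 * v) ≤ t := by rw [htu]; nlinarith
  have hs0 : 0 < n * (2 * v) := by positivity
  have huv : u ≤ v * ω := by
    have := div_sqrt_le_arsinh hu0
    rwa [div_le_iff₀ (by linarith)] at this
  have h1 := norm_oscSemigroup_sub_le hω1 hs0 hst
  have h2 : (t - n * (2 * v)) / (n * (2 * v)) ≤ u ^ 2 / 2 := by
    rw [div_le_iff₀ hs0, htu]
    have : u - v ≤ v * (u ^ 2 / 2) := by nlinarith
    nlinarith
  have h3 : ‖oscSemigroup ω (n * (2 * v)) - oscSemigroup 1 t‖ ≤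
      Real.exp (-(n * (2 * v)) / 4) * t ^ 2 * ((n : ℝ) ^ 2)⁻¹ := by
    refine h1.trans ?_
    calc _ ≤ Real.exp (-(n * (2 * v)) / 4) * (6 * (u ^ 2 / 2) + 2 * (u ^ 2 / 2)) := by
          gcongr; linarith
      _ = _ := by rw [hu]; field_simp; ring
  have hE1 : Real.exp (-(n * (2 * v)) / 4) ≤ 1 := Real.exp_le_one_iff.2 (by linarith)
  rcases le_total t 1 with ht1 | ht1
  · rw [min_eq_left ht1]
    refine h3.trans (mul_le_mul_of_nonneg_right ?_ (by positivity))
    calc Real.exp (-(n * (2 * v)) / 4) * t ^ 2 ≤ 1 * t ^ 2 := by gcongr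
      _ ≤ 64 * t := by nlinarith
  · rw [min_eq_right ht1]
    rcases le_or_gt 4 n with h4 | h4
    · refine h3.trans (mul_le_mul_of_nonneg_right ?_ (by positivity))
      rw [mul_comm, mul_one]
      exact hexp h4
    · have h5 : (n : ℝ) ≤ 4 := by exact_mod_cast h4.le
      have h6 : ‖oscSemigroup ω (n * (2 * v)) - oscSemigroup 1 t‖ ≤ 2 := by
        refine (norm_sub_le _ _).trans ?_
        linarith [norm_oscSemigroup_le_one ω (n * (2 * v)), norm_oscSemigroup_le_one 1 t]
      refine h6.trans ?_
      rw [← div_eq_mul_inv, le_div_iff₀ (by positivity)]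
      nlinarith

/-- The function `exp (-t / 2) t³ / (48 (1 + t)³)` of the lower bound. -/
noncomputable def lowerConstant : ℝ≥0 →ᵇ ℝ :=
  BoundedContinuousFunction.ofNormedAddCommGroup
    (fun t : ℝ≥0 => Real.exp (-t / 2) * ((t : ℝ) ^ 3 / (48 * (1 + t) ^ 3)))
    (by
      refine Continuous.mul (by fun_prop) (Continuous.div (by fun_prop) (by fun_prop) fun t => ?_)
      positivity) 1 fun t => by
      have ht : (0 : ℝ) ≤ t := t.2
      have h1 : Real.exp (-(t : ℝ) / 2) ≤ 1 := Real.exp_le_one_iff.2 (by linarith)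
      have h2 : (t : ℝ) ^ 3 / (48 * (1 + t) ^ 3) ≤ 1 := by
        rw [div_le_one (by positivity)]
        have : (t : ℝ) ^ 3 ≤ (1 + t) ^ 3 := by gcongr; linarith
        nlinarith [pow_nonneg ht 3]
      rw [Real.norm_of_nonneg (by positivity)]
      exact mul_le_one₀ h1 (by positivity) h2

/-- The function `64 min(t, 1)` of the upper bound. -/
noncomputable def upperConstant : ℝ≥0 →ᵇ ℝ :=
  BoundedContinuousFunction.ofNormedAddCommGroup (fun t : ℝ≥0 => 64 * min (t : ℝ) 1)
    (by fun_prop) 64 fun t => by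
      have h1 : (0 : ℝ) ≤ min (t : ℝ) 1 := le_min t.2 zero_le_one
      rw [Real.norm_of_nonneg (by positivity)]
      linarith [min_le_right (t : ℝ) 1]

theorem theorem3p1 :
    -- `V`, `H₀` and `H` do generate semigroups, so that the three exponentials are defined
    IsExpNeg potential (expNeg potential) ∧
    IsExpNeg freeHamiltonian (expNeg freeHamiltonian) ∧
    IsExpNeg harmonicOscillator (expNeg harmonicOscillator) ∧
    ∃ c C : ℝ≥0 →ᵇ ℝ,
      c 0 = 0 ∧ C 0 = 0 ∧ (∀ t : ℝ≥0, 0 < t → 0 < c t ∧ 0 < C t) ∧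
      ∀ n : ℕ, 1 ≤ n → ∀ t : ℝ≥0,
        c t * ((n : ℝ) ^ 2)⁻¹ ≤
          ‖(expNeg potential (t / (2 * n)) * expNeg freeHamiltonian (t / n) *
              expNeg potential (t / (2 * n))) ^ n - expNeg harmonicOscillator t‖ ∧
        ‖(expNeg potential (t / (2 * n)) * expNeg freeHamiltonian (t / n) *
            expNeg potential (t / (2 * n))) ^ n - expNeg harmonicOscillator t‖ ≤
          C t * ((n : ℝ) ^ 2)⁻¹ := by
  refine ⟨isExpNeg_expNeg isExpNeg_potential, isExpNeg_expNeg isExpNeg_freeHamiltonian,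
    isExpNeg_expNeg isExpNeg_harmonicOscillator, lowerConstant, upperConstant, ?_, ?_, ?_, ?_⟩
  · simp [lowerConstant]
  · simp [upperConstant]
  · intro t ht
    have ht' : (0 : ℝ) < t := NNReal.coe_pos.2 ht
    constructor
    · change 0 < Real.exp (-t / 2) * ((t : ℝ) ^ 3 / (48 * (1 + t) ^ 3))
      positivity
    · exact mul_pos (by norm_num) (lt_min ht' one_pos)
  · intro n hn t
    rw [expNeg_potential, expNeg_freeHamiltonian, expNeg_harmonicOscillator]
    have e1 : ((t / (2 * n) : ℝ≥0) : ℝ) = t / (2 * n) := by push_cast; rfl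
    have e2 : ((t / n : ℝ≥0) : ℝ) = 2 * (t / (2 * n)) := by push_cast; ring
    simp only [e1, e2]
    exact ⟨le_norm_product_sub hn t.2, norm_product_sub_le hn t.2⟩
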